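/- Let $n\ge 2$. For Schwartz functions $f,g$ on $\mathbb{R}^n$ and $\delta>0$, the bilinear Bochner–Riesz operator is $$S^\delta(f,g)(x)=\iint_{|\xi|^2+|\eta|^2\le 1}\bigl(1-|\xi|^2-|\eta|^2\bigr)^{\delta}\,\widehat f(\xi)\,\widehat g(\eta)\,e^{2\pi i x\cdot(\xi+\eta)}\,d\xi\,d\eta ,\qquad \widehat f(\xi)=\int_{\mathbb{R}^n}e^{-2\pi i x\cdot\xi}f(x)\,dx .$$ Let $p,q,r'\in[1,\infty)$ with $\frac1p+\frac1q+\frac1{r'}=1$, and let $r$ be the exponent conjugate to $r'$, i.e. $\frac1r=1-\frac1{r'}=\frac1p+\frac1q$. Then $S^\delta$ is bounded from $L^p(\mathbb{R}^n)\times L^q(\mathbb{R}^n)$ to $L^r(\mathbb{R}^n)$, that is, it extends from pairs of Schwartz functions to a bounded bilinear operator $L^p(\mathbb{R}^n)\times L^q(\mathbb{R}^n)\to L^r(\mathbb{R}^n)$, in each of the following cases: (a) $p,q\in[2,\infty)$, $r'<2$ and $\delta>\frac{n-1}{2}+n\bigl(\frac1{r'}-\frac12\bigr)$; (b) $q,r'\in[2,\infty)$,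 $p<2$ and $\delta>n\bigl(\frac12-\frac1q\bigr)-\frac1{r'}$; (c) $p,r'\in[2,\infty)$, $q<2$ and $\delta>n\bigl(\frac12-\frac1p\bigr)-\frac1{r'}$. -/

import Mathlib

open MeasureTheory FourierTransform SchwartzMap

noncomputable section

/-- The bilinear Bochner-Riesz means of order `δ` on `ℝⁿ`, for Schwartz functions `f`, `g`:
`S^δ(f,g)(x) = ∬_{|ξ|² + |η|² ≤ 1} e^{2πi x·(ξ+η)} (1 - |ξ|² - |η|²)^δ f̂(ξ) ĝ(η) dξ dη`,
where `f̂(ξ) = ∫ e^{-2πi x·ξ} f(x) dx`. -/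
def bilinearBochnerRiesz (n : ℕ) (δ : ℝ) (f g : 𝓢(EuclideanSpace ℝ (Fin n), ℂ))
    (x : EuclideanSpace ℝ (Fin n)) : ℂ :=
  ∫ z : EuclideanSpace ℝ (Fin n) × EuclideanSpace ℝ (Fin n) in
      {z | ‖z.1‖ ^ 2 + ‖z.2‖ ^ 2 ≤ 1},
    Complex.exp (2 * Real.pi * Complex.I * (inner ℝ x (z.1 + z.2) : ℝ)) *
      (((1 - ‖z.1‖ ^ 2 - ‖z.2‖ ^ 2) ^ δ : ℝ) : ℂ) *
      (𝓕 (f : EuclideanSpace ℝ (Fin n) → ℂ) z.1) *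
      (𝓕 (g : EuclideanSpace ℝ (Fin n) → ℂ) z.2)

/-- An operator `S`, given on pairs of Schwartz functions, is bounded from
`L^p(ℝⁿ) × L^q(ℝⁿ)` to `L^r(ℝⁿ)`: there is a bilinear map `T : L^p × L^q → L^r` with
`‖T(F,G)‖_r ≤ C ‖F‖_p ‖G‖_q` for all `F ∈ L^p`, `G ∈ L^q`,
which agrees with `S` on Schwartz functions. The exponents are positive real numbers. -/
def IsBoundedBilinearOp (n : ℕ) (p q r : ℝ)
    (S : 𝓢(EuclideanSpace ℝ (Fin n), ℂ) → 𝓢(EuclideanSpace ℝ (Fin n), ℂ) →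
      EuclideanSpace ℝ (Fin n) → ℂ) : Prop :=
  ∃ (T : Lp (α := EuclideanSpace ℝ (Fin n)) ℂ (ENNReal.ofReal p) volume →ₗ[ℂ]
        Lp (α := EuclideanSpace ℝ (Fin n)) ℂ (ENNReal.ofReal q) volume →ₗ[ℂ]
        Lp (α := EuclideanSpace ℝ (Fin n)) ℂ (ENNReal.ofReal r) volume) (C : ℝ),
    (∀ F G, ‖T F G‖ ≤ C * ‖F‖ * ‖G‖) ∧
    ∀ f g : 𝓢(EuclideanSpace ℝ (Fin n), ℂ),
      (T (f.toLp (ENNReal.ofReal p) volume) (g.toLp (ENNReal.ofReal q) volume) :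
        EuclideanSpace ℝ (Fin n) → ℂ) =ᵐ[volume] S f g

end

/-!
Decompose the symbol dyadically near the sphere `|ξ|² + |η|² = 1`:
`(1 - |ξ|² - |η|²)₊ ^ δ = ∑ⱼ 2 ^ (-jδ) φ (2 ^ j (1 - |ξ|² - |η|²))`, with `φ` smooth and supported
in `[1/2, 2]`. The shell `φ (t (1 - |ξ|² - |η|²))` of thickness `1 / t` acts on frequency-side
`L² × L²` with a gain `t ^ (-min (1/2) (1 - 1/s))` in `L^s`. For `s = 2`, the sections of the shell
along `ξ + η = ζ` have measure `O(1 / t)` by the parallelogram law, and Cauchy-Schwarz on each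
section is followed by Plancherel; larger `s` cost nothing more, since the output has bounded
frequencies. For `s = 1`, Fourier inversion of `φ` makes the symbol a superposition of products of a
function of `ξ` and a function of `η`, and each product is handled by Plancherel. In between one
interpolates.

To pass from `L²` to `L^p` and `L^q`, note that the kernel of the shell operator decays rapidly
beyond distance `t`. Up to a negligible tail, `f` and `g` can therefore be localized to a ball of
radius `ρ = t ^ (1 + ε)`, where replacing `L^p` by `L²` costs `ρ ^ (n max(0, 1/2 - 1/p))`: for
`p ≥ 2` this is Hölder's inequality on the ball, and for `p ≤ 2` a dual Bernstein inequality, the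
frequencies being bounded. Averaging over the balls gives a bound `t ^ κ` for every `κ` larger than
the total loss minus the gain, and the resulting geometric series converges when `δ` exceeds it.
-/

open Set Filter
open scoped ENNReal NNReal RealInnerProductSpace Topology FourierTransform

section Lebesgue

variable {α E : Type*} [MeasurableSpace α] {μ : Measure α} [NormedAddCommGroup E] {f : α → E}

theorem eLpNorm_ofReal_eq_eLpNorm' {p : ℝ} (hp : 0 < p) :
    eLpNorm f (ENNReal.ofReal p) μ = eLpNorm' f p μ := by
  rw [eLpNorm_eq_eLpNorm' (by simpa using hp) ENNReal.ofReal_ne_top, ENNReal.toReal_ofReal hp.le]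

theorem eLpNorm_two_eq_eLpNorm' : eLpNorm f 2 μ = eLpNorm' f 2 μ := by
  simpa using eLpNorm_ofReal_eq_eLpNorm' (f := f) (μ := μ) zero_lt_two

theorem lintegral_enorm_mul_le_eLpNorm' {p q : ℝ} (hpq : p.HolderConjugate q) {f g : α → ℂ}
    (hf : AEStronglyMeasurable f μ) (hg : AEStronglyMeasurable g μ) :
    ∫⁻ x, ‖f x * g x‖ₑ ∂μ ≤ eLpNorm' f p μ * eLpNorm' g q μ := by
  simp_rw [enorm_mul]
  exact ENNReal.lintegral_mul_le_Lp_mul_Lq μ hpq hf.enorm hg.enorm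

theorem eLpNorm'_le_of_enorm_le (hf : AEStronglyMeasurable f μ) {r s : ℝ} (hr : 0 < r)
    (hrs : r ≤ s) {M : ℝ≥0∞} (hM : ∀ x, ‖f x‖ₑ ≤ M) :
    eLpNorm' f s μ ≤ M ^ (1 - r / s) * eLpNorm' f r μ ^ (r / s) := by
  have hs : 0 < s := hr.trans_le hrs
  have hpointwise (x : α) : ‖f x‖ₑ ^ s ≤ M ^ (s - r) * ‖f x‖ₑ ^ r := by
    conv_lhs => rw [← sub_add_cancel s r]
    rw [ENNReal.rpow_add_of_nonneg _ _ (sub_nonneg.2 hrs) hr.le]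
    exact mul_le_mul_left (ENNReal.rpow_le_rpow (hM x) (sub_nonneg.2 hrs)) _
  calc eLpNorm' f s μ ≤ (∫⁻ x, M ^ (s - r) * ‖f x‖ₑ ^ r ∂μ) ^ (1 / s) := by
        rw [eLpNorm']
        gcongr with x
        exact hpointwise x
    _ = M ^ (1 - r / s) * eLpNorm' f r μ ^ (r / s) := by
        rw [lintegral_const_mul'' _ (hf.enorm.pow_const _),
          lintegral_rpow_enorm_eq_rpow_eLpNorm' hr, ENNReal.mul_rpow_of_nonneg _ _ (by positivity),
          ← ENNReal.rpow_mul, ← ENNReal.rpow_mul,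
          mul_one_div, mul_one_div, sub_div, div_self hs.ne']

theorem eLpNorm'_le_interpolate_one_two (hf : AEStronglyMeasurable f μ) {s : ℝ} (hs1 : 1 ≤ s)
    (hs2 : s ≤ 2) :
    eLpNorm' f s μ ≤ eLpNorm' f 1 μ ^ (2 / s - 1) * eLpNorm' f 2 μ ^ (2 - 2 / s) := by
  have hs : 0 < s := by linarith
  have hsplit (x : α) : ‖f x‖ₑ ^ (2 - s) * (‖f x‖ₑ ^ (2 : ℝ)) ^ (s - 1) = ‖f x‖ₑ ^ s := by
    rw [← ENNReal.rpow_mul, ← ENNReal.rpow_add_of_nonneg _ _ (by linarith) (by linarith)]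
    ring_nf
  have hHolder : ∫⁻ x, ‖f x‖ₑ ^ s ∂μ ≤
      eLpNorm' f 1 μ ^ (2 - s) * (eLpNorm' f 2 μ ^ (2 : ℝ)) ^ (s - 1) := by
    have h := ENNReal.lintegral_mul_norm_pow_le hf.enorm (hf.enorm.pow_const (2 : ℝ)) (p := 2 - s)
      (q := s - 1) (by linarith) (by linarith) (by ring)
    simp_rw [hsplit] at h
    rw [← lintegral_rpow_enorm_eq_rpow_eLpNorm' zero_lt_two]
    simpa only [eLpNorm', ENNReal.rpow_one, div_one] using h
  calc eLpNorm' f s μ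
      ≤ (eLpNorm' f 1 μ ^ (2 - s) * (eLpNorm' f 2 μ ^ (2 : ℝ)) ^ (s - 1)) ^ (1 / s) := by
        rw [eLpNorm']
        gcongr
    _ = eLpNorm' f 1 μ ^ (2 / s - 1) * eLpNorm' f 2 μ ^ (2 - 2 / s) := by
        rw [ENNReal.mul_rpow_of_nonneg _ _ (by positivity), ← ENNReal.rpow_mul, ← ENNReal.rpow_mul,
          ← ENNReal.rpow_mul]
        congr 2 <;> field_simp

end Lebesgue

section Character

variable {X α : Type*} [TopologicalSpace X] [TopologicalSpace α] [MeasurableSpace α]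
  [OpensMeasurableSpace α] {μ : Measure α} {g : α → ℝ} {f : α → ℂ}

theorem enorm_circle_smul (c : Circle) (z : ℂ) : ‖c • z‖ₑ = ‖z‖ₑ := by
  rw [← ofReal_norm, Circle.norm_smul, ofReal_norm]

theorem continuous_coe_fourierChar_comp {g : X → ℝ} (hg : Continuous g) :
    Continuous fun x => (Real.fourierChar (g x) : ℂ) :=
  continuous_subtype_val.comp (Real.continuous_fourierChar.comp hg)

theorem aestronglyMeasurable_fourierChar_smul (hg : Continuous g)
    (hf : AEStronglyMeasurable f μ) :
    AEStronglyMeasurable (fun x => Real.fourierChar (g x) • f x) μ := by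
  simp_rw [Circle.smul_def]
  exact (continuous_coe_fourierChar_comp hg).aestronglyMeasurable.smul hf

theorem memLp_fourierChar_smul {s : ℝ≥0∞} (hg : Continuous g) (hf : MemLp f s μ) :
    MemLp (fun x => Real.fourierChar (g x) • f x) s μ :=
  hf.mono (aestronglyMeasurable_fourierChar_smul hg hf.1)
    (.of_forall fun _ => (Circle.norm_smul _ _).le)

theorem integrable_fourierChar_smul (hg : Continuous g) (hf : Integrable f μ) :
    Integrable (fun x => Real.fourierChar (g x) • f x) μ :=
  memLp_one_iff_integrable.1 (memLp_fourierChar_smul hg (memLp_one_iff_integrable.2 hf))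

theorem continuous_integral_fourierChar_smul [FirstCountableTopology X] {g : X → α → ℝ}
    (hg : Continuous fun z : X × α => g z.1 z.2) (hf : Integrable f μ) :
    Continuous fun x => ∫ a, Real.fourierChar (g x a) • f a ∂μ := by
  refine continuous_of_dominated (bound := fun a => ‖f a‖) (fun x => ?_) (fun _ => ?_) hf.norm ?_
  · exact aestronglyMeasurable_fourierChar_smul (hg.comp (Continuous.prodMk_right x)) hf.1
  · exact .of_forall fun _ => (Circle.norm_smul _ _).le
  · refine .of_forall fun a => ?_
    simp_rw [Circle.smul_def]
    exact (continuous_coe_fourierChar_comp (hg.comp (Continuous.prodMk_left a))).smul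
      continuous_const

end Character

section Fourier

variable {V : Type*} [NormedAddCommGroup V] [InnerProductSpace ℝ V] [FiniteDimensional ℝ V]
  [MeasurableSpace V] [BorelSpace V]

theorem continuous_fourier_of_integrable {f : V → ℂ} (hf : Integrable f) : Continuous (𝓕 f) := by
  rw [show 𝓕 f = fun ξ => ∫ v, Real.fourierChar (-⟪v, ξ⟫) • f v from funext (Real.fourier_eq f)]
  exact continuous_integral_fourierChar_smul (by fun_prop) hf

theorem enorm_fourier_le (f : V → ℂ) (ξ : V) : ‖𝓕 f ξ‖ₑ ≤ ∫⁻ x, ‖f x‖ₑ := by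
  rw [Real.fourier_eq]
  exact (enorm_integral_le_lintegral_enorm _).trans_eq
    (lintegral_congr fun x => enorm_circle_smul _ _)

theorem eLpNorm'_fourierInv (f : V → ℂ) (s : ℝ) :
    eLpNorm' (𝓕⁻ f) s volume = eLpNorm' (𝓕 f) s volume := by
  simp only [eLpNorm', Real.fourierInv_eq_fourier_neg]
  rw [lintegral_neg_eq_self fun ξ => ‖𝓕 f ξ‖ₑ ^ s]

theorem fourier_toLp_two_ae_eq {f : V → ℂ} (hf : Integrable f) (hf2 : MemLp f 2) :
    ((𝓕 (hf2.toLp f) : Lp (α := V) ℂ 2) : V → ℂ) =ᵐ[volume] 𝓕 f := by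
  refine ae_eq_of_integral_contDiff_smul_eq
    ((Lp.memLp (𝓕 (hf2.toLp f) : Lp ℂ 2 (volume : Measure V))).locallyIntegrable (by norm_num))
    (continuous_fourier_of_integrable hf).locallyIntegrable fun g hg hgc => ?_
  have hgℂ : ContDiff ℝ (⊤ : ℕ∞) (fun x => (g x : ℂ)) := Complex.ofRealCLM.contDiff.comp hg
  have hgcℂ : HasCompactSupport (fun x => (g x : ℂ)) :=
    hgc.comp_left (g := fun t : ℝ => (t : ℂ)) Complex.ofReal_zero
  set G : 𝓢(V, ℂ) := hgcℂ.toSchwartzMap hgℂ with hG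
  have hdistrib := congrArg (fun T => T G) (Lp.fourier_toTemperedDistribution_eq (hf2.toLp f))
  simp only [TemperedDistribution.fourier_apply, Lp.toTemperedDistribution_apply] at hdistrib
  have hcongr : ∫ x, (𝓕 G) x • (hf2.toLp f : V → ℂ) x = ∫ x, (𝓕 G) x • f x :=
    integral_congr_ae (by filter_upwards [hf2.coeFn_toLp] with x hx; rw [hx])
  have hflip : ∫ ξ, (𝓕 (G : V → ℂ)) ξ • f ξ = ∫ x, G x • (𝓕 f) x := by
    have := VectorFourier.integral_fourierIntegral_smul_eq_flip (μ := (volume : Measure V))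
      (ν := (volume : Measure V)) (L := innerₗ V) (f := (G : V → ℂ)) (g := f)
      Real.continuous_fourierChar (by exact continuous_inner) G.integrable hf
    rwa [flip_innerₗ] at this
  rw [hcongr, SchwartzMap.fourier_coe, hflip] at hdistrib
  simpa [hG] using hdistrib.symm

theorem eLpNorm'_fourier_two {f : V → ℂ} (hf : Integrable f) (hf2 : MemLp f 2) :
    eLpNorm' (𝓕 f) 2 volume = eLpNorm' f 2 volume := by
  rw [← eLpNorm_two_eq_eLpNorm', ← eLpNorm_two_eq_eLpNorm',
    ← eLpNorm_congr_ae (fourier_toLp_two_ae_eq hf hf2), ← eLpNorm_congr_ae hf2.coeFn_toLp,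
    ← Lp.enorm_def, ← Lp.enorm_def, ← ofReal_norm, ← ofReal_norm, Lp.norm_fourier_eq]

theorem lintegral_enorm_le_of_support_subset {f : V → ℂ} (hf : AEStronglyMeasurable f) {B : Set V}
    (hfB : Function.support f ⊆ B) :
    ∫⁻ x, ‖f x‖ₑ ≤ volume B ^ (1 / 2 : ℝ) * eLpNorm' f 2 volume := by
  have hJensen := eLpNorm'_le_eLpNorm'_mul_rpow_measure_univ (f := f)
    (μ := volume.restrict B) zero_lt_one one_le_two hf.restrict
  norm_num [eLpNorm'] at hJensen
  have hsupp : Function.support (fun x => ‖f x‖ₑ) ⊆ B := fun x hx =>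
    hfB (by simpa using hx)
  calc ∫⁻ x, ‖f x‖ₑ = ∫⁻ x in B, ‖f x‖ₑ := (setLIntegral_eq_of_support_subset hsupp).symm
    _ ≤ eLpNorm' f 2 (volume.restrict B) * volume B ^ (1 / 2 : ℝ) := by
        simpa [eLpNorm'] using hJensen
    _ ≤ eLpNorm' f 2 volume * volume B ^ (1 / 2 : ℝ) := by
        gcongr
        exact Measure.restrict_le_self
    _ = _ := mul_comm _ _

theorem eLpNorm'_fourierInv_le_of_support_subset {f : V → ℂ} (hf : Integrable f) (hf2 : MemLp f 2)
    {B : Set V} (hfB : Function.support f ⊆ B) {s : ℝ} (hs : 2 ≤ s) :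
    eLpNorm' (𝓕⁻ f) s volume ≤ volume B ^ (1 / 2 - 1 / s) * eLpNorm' f 2 volume := by
  have hs0 : 0 < s := by linarith
  have hs1 : 2 / s ≤ 1 := (div_le_one hs0).2 hs
  rw [eLpNorm'_fourierInv]
  calc eLpNorm' (𝓕 f) s volume
      ≤ (volume B ^ (1 / 2 : ℝ) * eLpNorm' f 2 volume) ^ (1 - 2 / s) *
          eLpNorm' (𝓕 f) 2 volume ^ (2 / s) :=
        eLpNorm'_le_of_enorm_le (continuous_fourier_of_integrable hf).aestronglyMeasurable
          zero_lt_two hs fun ξ => (enorm_fourier_le f ξ).trans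
            (lintegral_enorm_le_of_support_subset hf.1 hfB)
    _ = volume B ^ (1 / 2 - 1 / s) * eLpNorm' f 2 volume := by
        rw [eLpNorm'_fourier_two hf hf2, ENNReal.mul_rpow_of_nonneg _ _ (by linarith),
          ← ENNReal.rpow_mul, mul_assoc, ← ENNReal.rpow_add_of_nonneg _ _ (by linarith)
          (by positivity), sub_add_cancel, ENNReal.rpow_one]
        congr 2
        ring

theorem memLp_indicator_fourier {f : V → ℂ} (hf : Integrable f) {B : Set V} (hB : MeasurableSet B)
    (hBv : volume B ≠ ∞) (s : ℝ≥0∞) : MemLp (B.indicator (𝓕 f)) s := by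
  rw [memLp_indicator_iff_restrict hB]
  have : IsFiniteMeasure (volume.restrict B) := ⟨by simpa using hBv.lt_top⟩
  refine MemLp.of_bound (continuous_fourier_of_integrable hf).aestronglyMeasurable
    (∫⁻ x, ‖f x‖ₑ).toReal (.of_forall fun ξ => ?_)
  rw [← toReal_enorm]
  exact ENNReal.toReal_mono hf.2.ne (enorm_fourier_le f ξ)

theorem eLpNorm'_indicator_fourier_sq {f : V → ℂ} (hf : Integrable f) {B : Set V}
    (hB : MeasurableSet B) (hBv : volume B ≠ ∞) :
    eLpNorm' (B.indicator (𝓕 f)) 2 volume ^ (2 : ℝ) =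
      ‖∫ x, inner ℂ (f x) (𝓕⁻ (B.indicator (𝓕 f)) x)‖ₑ := by
  set G : V → ℂ := B.indicator (𝓕 f) with hG
  have hG2 : MemLp G 2 := memLp_indicator_fourier hf hB hBv 2
  have hdual : ∫ ξ, inner ℂ (𝓕 f ξ) (G ξ) = ∫ x, inner ℂ (f x) (𝓕⁻ G x) := by
    have := VectorFourier.integral_sesq_fourierIntegral_eq_neg_flip (innerSL ℂ)
      (μ := (volume : Measure V)) (ν := (volume : Measure V)) (L := innerₗ V)
      Real.continuous_fourierChar continuous_inner hf
      (memLp_one_iff_integrable.1 (memLp_indicator_fourier hf hB hBv 1))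
    rwa [flip_innerₗ] at this
  have hdiag (ξ : V) : inner ℂ (𝓕 f ξ) (G ξ) = ((‖G ξ‖ ^ 2 : ℝ) : ℂ) := by
    by_cases hξ : ξ ∈ B
    · rw [hG, indicator_of_mem hξ]
      exact_mod_cast inner_self_eq_norm_sq_to_K (𝕜 := ℂ) (𝓕 f ξ)
    · simp [hG, hξ]
  rw [← hdual, ← lintegral_rpow_enorm_eq_rpow_eLpNorm' zero_lt_two]
  simp_rw [hdiag]
  rw [integral_complex_ofReal, ← ofReal_norm, Complex.norm_real,
    Real.norm_of_nonneg (integral_nonneg fun _ => by positivity),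
    ofReal_integral_eq_lintegral_ofReal (hG2.integrable_norm_pow two_ne_zero)
      (.of_forall fun _ => by positivity)]
  simp [ENNReal.ofReal_pow]

theorem eLpNorm'_indicator_fourier_le_of_le_two {p : ℝ} (hp : 1 < p) (hp2 : p ≤ 2) {f : V → ℂ}
    (hf : Integrable f) {B : Set V} (hB : MeasurableSet B) (hBv : volume B ≠ ∞) :
    eLpNorm' (B.indicator (𝓕 f)) 2 volume ≤ volume B ^ (1 / p - 1 / 2) * eLpNorm' f p volume := by
  have hpp' := Real.HolderConjugate.conjExponent hp
  set p' := p.conjExponent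
  have hp'2 : 2 ≤ p' := by
    simp only [p', Real.conjExponent, le_div_iff₀ (sub_pos.2 hp)]
    linarith
  have hexp : 1 / p - 1 / 2 = 1 / 2 - 1 / p' := by
    have := hpp'.one_div_add_one_div
    linarith
  set G : V → ℂ := B.indicator (𝓕 f)
  have hGi : Integrable G := memLp_one_iff_integrable.1 (memLp_indicator_fourier hf hB hBv 1)
  have hG2 : MemLp G 2 := memLp_indicator_fourier hf hB hBv 2
  have hfin : eLpNorm' G 2 volume ≠ ∞ := eLpNorm_two_eq_eLpNorm' (f := G) ▸ hG2.2.ne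
  have hselfdual : eLpNorm' G 2 volume * eLpNorm' G 2 volume ≤
      volume B ^ (1 / p - 1 / 2) * eLpNorm' f p volume * eLpNorm' G 2 volume :=
    calc eLpNorm' G 2 volume * eLpNorm' G 2 volume
        = ‖∫ x, inner ℂ (f x) (𝓕⁻ G x)‖ₑ := by
          rw [← eLpNorm'_indicator_fourier_sq hf hB hBv, ENNReal.rpow_two, sq]
      _ ≤ ∫⁻ x, ‖f x * 𝓕⁻ G x‖ₑ := (enorm_integral_le_lintegral_enorm _).trans <|
          lintegral_mono fun x => by simp [RCLike.inner_apply, enorm_mul, mul_comm]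
      _ ≤ eLpNorm' f p volume * eLpNorm' (𝓕⁻ G) p' volume :=
          lintegral_enorm_mul_le_eLpNorm' hpp' hf.1 (by
            simp_rw [funext (Real.fourierInv_eq_fourier_neg G)]
            exact ((continuous_fourier_of_integrable hGi).comp
              continuous_neg).aestronglyMeasurable)
      _ ≤ eLpNorm' f p volume * (volume B ^ (1 / 2 - 1 / p') * eLpNorm' G 2 volume) := by
          gcongr
          exact eLpNorm'_fourierInv_le_of_support_subset hGi hG2 support_indicator_subset hp'2
      _ = _ := by rw [hexp]; ring
  by_cases h0 : eLpNorm' G 2 volume = 0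
  · simp [h0]
  · exact (ENNReal.mul_le_mul_iff_left h0 hfin).1 hselfdual

end Fourier

section BilinearMultiplier

variable {V : Type*} [NormedAddCommGroup V] [InnerProductSpace ℝ V] [FiniteDimensional ℝ V]
  [MeasurableSpace V] [BorelSpace V] {m : V × V → ℂ} {U W : V → ℂ}

/-- The bilinear Fourier multiplier operator with symbol `m`, as a function of the Fourier
transforms `U` and `W` of its two arguments. -/
noncomputable def bilinearMultiplier (m : V × V → ℂ) (U W : V → ℂ) (x : V) : ℂ :=
  ∫ z : V × V, Real.fourierChar ⟪x, z.1 + z.2⟫ • (m z * U z.1 * W z.2)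

/-- The convolution of `U` and `W` weighted by the symbol `m`: the Fourier transform of
`bilinearMultiplier m U W`. -/
noncomputable def symbolConvolution (m : V × V → ℂ) (U W : V → ℂ) (ζ : V) : ℂ :=
  ∫ ξ, m (ξ, ζ - ξ) * U ξ * W (ζ - ξ)

theorem integrable_symbol_mul (hm : Measurable m) {M : ℝ} (hmM : ∀ z, ‖m z‖ ≤ M)
    (hU : Integrable U) (hW : Integrable W) :
    Integrable fun z : V × V => m z * U z.1 * W z.2 := by
  simp_rw [mul_assoc]
  exact (hU.mul_prod hW).bdd_mul hm.aestronglyMeasurable (.of_forall hmM)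

theorem integrable_symbol_mul_sub (hm : Measurable m) {M : ℝ} (hmM : ∀ z, ‖m z‖ ≤ M)
    (hU : Integrable U) (hW : Integrable W) :
    Integrable fun z : V × V => m (z.1, z.2 - z.1) * U z.1 * W (z.2 - z.1) :=
  (measurePreserving_prod_sub volume volume).integrable_comp_of_integrable
    (integrable_symbol_mul hm hmM hU hW)

theorem integrable_symbolConvolution (hm : Measurable m) {M : ℝ} (hmM : ∀ z, ‖m z‖ ≤ M)
    (hU : Integrable U) (hW : Integrable W) : Integrable (symbolConvolution m U W) :=
  (integrable_symbol_mul_sub hm hmM hU hW).integral_prod_right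

theorem bilinearMultiplier_eq_fourierInv (hm : Measurable m) {M : ℝ} (hmM : ∀ z, ‖m z‖ ≤ M)
    (hU : Integrable U) (hW : Integrable W) :
    bilinearMultiplier m U W = 𝓕⁻ (symbolConvolution m U W) := by
  ext x
  have hint := integrable_fourierChar_smul
    (by fun_prop : Continuous fun z : V × V => ⟪x, z.1 + z.2⟫)
    (integrable_symbol_mul hm hmM hU hW)
  have hint_sub := integrable_fourierChar_smul (by fun_prop : Continuous fun z : V × V => ⟪x, z.2⟫)
    (integrable_symbol_mul_sub hm hmM hU hW)
  calc bilinearMultiplier m U W x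
      = ∫ ξ, ∫ η, Real.fourierChar ⟪x, ξ + η⟫ • (m (ξ, η) * U ξ * W η) := integral_prod _ hint
    _ = ∫ ξ, ∫ ζ, Real.fourierChar ⟪x, ζ⟫ • (m (ξ, ζ - ξ) * U ξ * W (ζ - ξ)) := by
        congr! 2 with ξ
        rw [← integral_sub_right_eq_self _ ξ]
        simp only [add_sub_cancel]
    _ = ∫ ζ, ∫ ξ, Real.fourierChar ⟪x, ζ⟫ • (m (ξ, ζ - ξ) * U ξ * W (ζ - ξ)) :=
        integral_integral_swap hint_sub
    _ = 𝓕⁻ (symbolConvolution m U W) x := by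
        simp only [Real.fourierInv_eq, symbolConvolution, Circle.smul_def, integral_smul,
          real_inner_comm]

theorem continuous_bilinearMultiplier (h : Integrable fun z : V × V => m z * U z.1 * W z.2) :
    Continuous (bilinearMultiplier m U W) :=
  continuous_integral_fourierChar_smul (by fun_prop) h

theorem aemeasurable_mul_sub {f g : V → ℝ≥0∞} (hf : AEMeasurable f) (hg : AEMeasurable g) :
    AEMeasurable (fun z : V × V => f z.2 * g (z.1 - z.2)) (volume.prod volume) :=
  hf.comp_snd.mul <| hg.comp_fst.comp_quasiMeasurePreserving
    (measurePreserving_sub_prod volume volume).quasiMeasurePreserving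

theorem lintegral_lintegral_mul_sub {f g : V → ℝ≥0∞} (hf : AEMeasurable f) (hg : AEMeasurable g) :
    ∫⁻ ζ, ∫⁻ ξ, f ξ * g (ζ - ξ) = (∫⁻ ξ, f ξ) * ∫⁻ ξ, g ξ := by
  rw [lintegral_lintegral_swap (aemeasurable_mul_sub hf hg), ← lintegral_mul_const'' _ hf]
  refine lintegral_congr fun ξ => ?_
  have hgξ : AEMeasurable fun ζ => g (ζ - ξ) := hg.comp_quasiMeasurePreserving
    (measurePreserving_sub_right volume ξ).quasiMeasurePreserving
  rw [lintegral_const_mul'' _ hgξ, lintegral_sub_right_eq_self g]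

theorem enorm_symbolConvolution_sq_le (hm : Measurable m) {D : ℝ≥0∞}
    (hD : ∀ ζ, ∫⁻ ξ, ‖m (ξ, ζ - ξ)‖ₑ ^ (2 : ℝ) ≤ D ^ (2 : ℝ)) (hU : AEStronglyMeasurable U)
    (hW : AEStronglyMeasurable W) (ζ : V) :
    ‖symbolConvolution m U W ζ‖ₑ ^ (2 : ℝ) ≤
      D ^ (2 : ℝ) * ∫⁻ ξ, ‖U ξ‖ₑ ^ (2 : ℝ) * ‖W (ζ - ξ)‖ₑ ^ (2 : ℝ) := by
  have hWζ : AEStronglyMeasurable fun ξ => W (ζ - ξ) :=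
    hW.comp_quasiMeasurePreserving (quasiMeasurePreserving_sub_left volume ζ)
  have hmζ : Measurable fun ξ => m (ξ, ζ - ξ) := by fun_prop
  calc ‖symbolConvolution m U W ζ‖ₑ ^ (2 : ℝ)
      ≤ (∫⁻ ξ, ‖m (ξ, ζ - ξ) * (U ξ * W (ζ - ξ))‖ₑ) ^ (2 : ℝ) := by
        simp_rw [symbolConvolution, mul_assoc]
        gcongr
        exact enorm_integral_le_lintegral_enorm _
    _ ≤ (eLpNorm' (fun ξ => m (ξ, ζ - ξ)) 2 volume *
          eLpNorm' (fun ξ => U ξ * W (ζ - ξ)) 2 volume) ^ (2 : ℝ) := by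
        gcongr
        exact lintegral_enorm_mul_le_eLpNorm' .two_two hmζ.aestronglyMeasurable (hU.mul hWζ)
    _ ≤ _ := by
        rw [ENNReal.mul_rpow_of_nonneg _ _ zero_le_two,
          ← lintegral_rpow_enorm_eq_rpow_eLpNorm' zero_lt_two,
          ← lintegral_rpow_enorm_eq_rpow_eLpNorm' zero_lt_two]
        simp_rw [enorm_mul, ENNReal.mul_rpow_of_nonneg _ _ (zero_le_two (α := ℝ))]
        gcongr
        exact hD ζ

theorem eLpNorm'_symbolConvolution_le (hm : Measurable m) {D : ℝ≥0∞}
    (hD : ∀ ζ, ∫⁻ ξ, ‖m (ξ, ζ - ξ)‖ₑ ^ (2 : ℝ) ≤ D ^ (2 : ℝ)) (hU : AEStronglyMeasurable U)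
    (hW : AEStronglyMeasurable W) :
    eLpNorm' (symbolConvolution m U W) 2 volume ≤
      D * (eLpNorm' U 2 volume * eLpNorm' W 2 volume) := by
  have hU2 := hU.enorm.pow_const (2 : ℝ)
  have hW2 := hW.enorm.pow_const (2 : ℝ)
  rw [← ENNReal.rpow_le_rpow_iff zero_lt_two, ENNReal.mul_rpow_of_nonneg _ _ zero_le_two,
    ENNReal.mul_rpow_of_nonneg _ _ zero_le_two, ← lintegral_rpow_enorm_eq_rpow_eLpNorm' zero_lt_two,
    ← lintegral_rpow_enorm_eq_rpow_eLpNorm' zero_lt_two,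
    ← lintegral_rpow_enorm_eq_rpow_eLpNorm' zero_lt_two, ← lintegral_lintegral_mul_sub hU2 hW2,
    ← lintegral_const_mul'' _ (aemeasurable_mul_sub hU2 hW2).lintegral_prod_right']
  exact lintegral_mono (enorm_symbolConvolution_sq_le hm hD hU hW)

theorem support_symbolConvolution_subset {B : Set V} (hB : ∀ z : V × V, z.1 + z.2 ∉ B → m z = 0) :
    Function.support (symbolConvolution m U W) ⊆ B := by
  intro ζ hζ
  contrapose! hζ
  have hzero (ξ : V) : m (ξ, ζ - ξ) = 0 := hB _ (by simpa using hζ)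
  simp [symbolConvolution, hzero]

theorem eLpNorm'_bilinearMultiplier_le_of_two_le (hm : Measurable m) {M : ℝ}
    (hmM : ∀ z, ‖m z‖ ≤ M) (hU : Integrable U) (hW : Integrable W) (hU2 : MemLp U 2)
    (hW2 : MemLp W 2) {D : ℝ≥0∞} (hDtop : D ≠ ∞)
    (hD : ∀ ζ, ∫⁻ ξ, ‖m (ξ, ζ - ξ)‖ₑ ^ (2 : ℝ) ≤ D ^ (2 : ℝ)) {B : Set V}
    (hB : ∀ z : V × V, z.1 + z.2 ∉ B → m z = 0) {s : ℝ} (hs : 2 ≤ s) :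
    eLpNorm' (bilinearMultiplier m U W) s volume ≤
      volume B ^ (1 / 2 - 1 / s) * (D * (eLpNorm' U 2 volume * eLpNorm' W 2 volume)) := by
  have hle := eLpNorm'_symbolConvolution_le hm hD hU.1 hW.1
  have hint := integrable_symbolConvolution hm hmM hU hW
  have hmem : MemLp (symbolConvolution m U W) 2 := by
    refine ⟨hint.1, ?_⟩
    rw [eLpNorm_two_eq_eLpNorm']
    refine hle.trans_lt (ENNReal.mul_lt_top hDtop.lt_top (ENNReal.mul_lt_top ?_ ?_)) <;>
      rw [← eLpNorm_two_eq_eLpNorm']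
    exacts [hU2.2, hW2.2]
  rw [bilinearMultiplier_eq_fourierInv hm hmM hU hW]
  exact (eLpNorm'_fourierInv_le_of_support_subset hint hmem (support_symbolConvolution_subset hB)
    hs).trans (by gcongr)

/-- The inverse Fourier transform of `e^{2πiτa} U`, i.e. the evolution of `U` after time `τ` under
the multiplier `a`. It is what remains of each argument of a bilinear multiplier once its symbol
is written as a superposition of the characters `e^{2πiτ(a(ξ)+a(η))}`. -/
noncomputable def modulatedFourierInv (a : V → ℝ) (U : V → ℂ) (τ : ℝ) (x : V) : ℂ :=
  ∫ ξ, Real.fourierChar (⟪ξ, x⟫ + τ * a ξ) • U ξ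

theorem eLpNorm'_modulatedFourierInv {a : V → ℝ} (ha : Continuous a) (hU : Integrable U)
    (hU2 : MemLp U 2) (τ : ℝ) :
    eLpNorm' (modulatedFourierInv a U τ) 2 volume = eLpNorm' U 2 volume := by
  have h : modulatedFourierInv a U τ = 𝓕⁻ fun ξ => Real.fourierChar (τ * a ξ) • U ξ := by
    ext x
    simp_rw [modulatedFourierInv, Real.fourierInv_eq, smul_smul, AddChar.map_add_eq_mul]
  rw [h, eLpNorm'_fourierInv, eLpNorm'_fourier_two
    (integrable_fourierChar_smul (by fun_prop) hU) (memLp_fourierChar_smul (by fun_prop) hU2)]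
  simp_rw [eLpNorm', enorm_circle_smul]

theorem continuous_modulatedFourierInv {a : V → ℝ} (ha : Continuous a) (hU : Integrable U) :
    Continuous fun w : V × ℝ => modulatedFourierInv a U w.2 w.1 :=
  continuous_integral_fourierChar_smul (by fun_prop) hU

theorem bilinearMultiplier_eq_integral_mul {k : ℝ → ℂ} (hk : Integrable k) {a : V → ℝ}
    (ha : Continuous a) (hm : ∀ z, m z = ∫ τ, Real.fourierChar (τ * (a z.1 + a z.2)) • k τ)
    (hU : Integrable U) (hW : Integrable W) (x : V) :
    bilinearMultiplier m U W x =
      ∫ τ, k τ * (modulatedFourierInv a U τ x * modulatedFourierInv a W τ x) := by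
  have hint : Integrable (fun y : (V × V) × ℝ =>
      Real.fourierChar (⟪x, y.1.1 + y.1.2⟫ + y.2 * (a y.1.1 + a y.1.2)) •
        (U y.1.1 * W y.1.2 * k y.2)) ((volume.prod volume).prod volume) :=
    integrable_fourierChar_smul (by fun_prop) ((hU.mul_prod hW).mul_prod hk)
  calc bilinearMultiplier m U W x
      = ∫ z : V × V, ∫ τ, Real.fourierChar (⟪x, z.1 + z.2⟫ + τ * (a z.1 + a z.2)) •
          (U z.1 * W z.2 * k τ) := by
        refine integral_congr_ae (.of_forall fun z => ?_)
        simp only [hm z, Circle.smul_def, smul_eq_mul]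
        rw [← integral_mul_const, ← integral_mul_const, ← integral_const_mul]
        congr! 2
        rw [AddChar.map_add_eq_mul, Circle.coe_mul]
        ring
    _ = ∫ τ, ∫ z : V × V, Real.fourierChar (⟪x, z.1 + z.2⟫ + τ * (a z.1 + a z.2)) •
          (U z.1 * W z.2 * k τ) := integral_integral_swap hint
    _ = _ := by
        refine integral_congr_ae (.of_forall fun τ => ?_)
        simp only [modulatedFourierInv]
        rw [← integral_prod_mul, ← integral_const_mul]
        refine integral_congr_ae (.of_forall fun z => ?_)
        simp only [inner_add_right, mul_add, AddChar.map_add_eq_mul, Circle.smul_def,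
          Circle.coe_mul, smul_eq_mul, real_inner_comm]
        ring

theorem eLpNorm'_one_bilinearMultiplier_le {k : ℝ → ℂ} (hk : Integrable k) {a : V → ℝ}
    (ha : Continuous a) (hm : ∀ z, m z = ∫ τ, Real.fourierChar (τ * (a z.1 + a z.2)) • k τ)
    (hU : Integrable U) (hW : Integrable W) (hU2 : MemLp U 2) (hW2 : MemLp W 2) :
    eLpNorm' (bilinearMultiplier m U W) 1 volume ≤
      (∫⁻ τ, ‖k τ‖ₑ) * (eLpNorm' U 2 volume * eLpNorm' W 2 volume) := by
  have hcont := (continuous_modulatedFourierInv ha hU).mul (continuous_modulatedFourierInv ha hW)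
  have hslice (τ : ℝ) : ∫⁻ x, ‖modulatedFourierInv a U τ x * modulatedFourierInv a W τ x‖ₑ ≤
      eLpNorm' U 2 volume * eLpNorm' W 2 volume := by
    rw [← eLpNorm'_modulatedFourierInv ha hU hU2 τ, ← eLpNorm'_modulatedFourierInv ha hW hW2 τ]
    exact lintegral_enorm_mul_le_eLpNorm' .two_two
      ((continuous_modulatedFourierInv ha hU).comp (.prodMk_left τ)).aestronglyMeasurable
      ((continuous_modulatedFourierInv ha hW).comp (.prodMk_left τ)).aestronglyMeasurable
  simp only [eLpNorm', ENNReal.rpow_one, div_one]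
  calc ∫⁻ x, ‖bilinearMultiplier m U W x‖ₑ
      ≤ ∫⁻ x, ∫⁻ τ, ‖k τ‖ₑ * ‖modulatedFourierInv a U τ x * modulatedFourierInv a W τ x‖ₑ := by
        gcongr with x
        rw [bilinearMultiplier_eq_integral_mul hk ha hm hU hW x]
        exact (enorm_integral_le_lintegral_enorm _).trans_eq (by simp_rw [enorm_mul])
    _ = ∫⁻ τ, ∫⁻ x, ‖k τ‖ₑ * ‖modulatedFourierInv a U τ x * modulatedFourierInv a W τ x‖ₑ :=
        lintegral_lintegral_swap (hk.1.enorm.comp_snd.mul hcont.enorm.aemeasurable)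
    _ ≤ ∫⁻ τ, ‖k τ‖ₑ * (eLpNorm' U 2 volume * eLpNorm' W 2 volume) := by
        gcongr with τ
        rw [lintegral_const_mul' _ _ enorm_ne_top]
        gcongr
        exact hslice τ
    _ = _ := lintegral_mul_const'' _ hk.1.enorm

end BilinearMultiplier

theorem norm_sq_add_norm_sub_sq {V : Type*} [NormedAddCommGroup V] [InnerProductSpace ℝ V]
    (ξ ζ : V) :
    ‖ξ‖ ^ 2 + ‖ζ - ξ‖ ^ 2 = 2 * ‖ξ - (1 / 2 : ℝ) • ζ‖ ^ 2 + ‖ζ‖ ^ 2 / 2 := by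
  rw [norm_sub_sq_real, norm_sub_sq_real, inner_smul_right, norm_smul, real_inner_comm]
  norm_num
  ring

theorem pow_sub_pow_le_mul_sq_sub_sq {a b : ℝ} (ha : 0 ≤ a) (hab : a ≤ b) (hb : b ≤ 1) {n : ℕ}
    (hn : 2 ≤ n) : b ^ n - a ^ n ≤ n * (b ^ 2 - a ^ 2) := by
  have hb0 : 0 ≤ b := ha.trans hab
  calc b ^ n - a ^ n ≤ |b - a| * n * max |b| |a| ^ (n - 1) :=
        (le_abs_self _).trans (abs_pow_sub_pow_le b a n)
    _ = (b - a) * n * b ^ (n - 1) := by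
        rw [abs_of_nonneg (sub_nonneg.2 hab), abs_of_nonneg ha, abs_of_nonneg hb0, max_eq_left hab]
    _ ≤ (b - a) * n * b := by
        gcongr
        exact pow_le_of_le_one hb0 hb (by omega)
    _ ≤ (b - a) * n * (b + a) := by
        gcongr
        linarith
    _ = n * (b ^ 2 - a ^ 2) := by ring

section ShellSymbol

variable {V : Type*} [NormedAddCommGroup V] {φ : 𝓢(ℝ, ℂ)} {b t : ℝ}

/-- The symbol `φ(t(1 - |ξ|² - |η|²))`. When `φ` is supported in `[0, b]` it lives in a shell of
thickness `O(1/t)` inside the unit sphere of `V × V`. -/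
noncomputable def shellSymbol (φ : 𝓢(ℝ, ℂ)) (t : ℝ) (z : V × V) : ℂ :=
  φ (t * (1 - ‖z.1‖ ^ 2 - ‖z.2‖ ^ 2))

theorem continuous_shellSymbol (φ : 𝓢(ℝ, ℂ)) (t : ℝ) :
    Continuous (shellSymbol φ t : V × V → ℂ) :=
  φ.continuous.comp (by fun_prop)

theorem norm_shellSymbol_le (φ : 𝓢(ℝ, ℂ)) (t : ℝ) (z : V × V) :
    ‖shellSymbol φ t z‖ ≤ SchwartzMap.seminorm ℝ 0 0 φ :=
  SchwartzMap.norm_le_seminorm ℝ φ _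

theorem mem_closedBall_of_sq_add_sq_le_one {z : V × V} (hz : ‖z.1‖ ^ 2 + ‖z.2‖ ^ 2 ≤ 1) :
    z ∈ Metric.closedBall 0 1 := by
  rw [mem_closedBall_zero_iff, Prod.norm_def, max_le_iff]
  constructor <;> nlinarith [sq_nonneg ‖z.1‖, sq_nonneg ‖z.2‖]

theorem mem_closedBall_of_shellSymbol_ne_zero (hφ : Function.support φ ⊆ Icc 0 b) (ht : 0 < t)
    {z : V × V} (hz : shellSymbol φ t z ≠ 0) : z ∈ Metric.closedBall 0 1 := by
  have h := (hφ hz).1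
  rw [mul_nonneg_iff_of_pos_left ht] at h
  exact mem_closedBall_of_sq_add_sq_le_one (by linarith)

theorem tsupport_shellSymbol_subset (hφ : Function.support φ ⊆ Icc 0 b) (ht : 0 < t) :
    tsupport (shellSymbol φ t : V × V → ℂ) ⊆ Metric.closedBall 0 1 :=
  closure_minimal (fun _ hz => mem_closedBall_of_shellSymbol_ne_zero hφ ht hz)
    Metric.isClosed_closedBall

theorem shellSymbol_eq_zero_of_add_notMem (hφ : Function.support φ ⊆ Icc 0 b) (ht : 0 < t)
    {z : V × V} (hz : z.1 + z.2 ∉ Metric.closedBall 0 2) : shellSymbol φ t z = 0 := by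
  contrapose! hz
  have h := mem_closedBall_of_shellSymbol_ne_zero hφ ht hz
  rw [mem_closedBall_zero_iff, Prod.norm_def, max_le_iff] at h
  rw [mem_closedBall_zero_iff]
  exact (norm_add_le _ _).trans (by linarith)

/-- Fourier inversion of `φ` decouples the two frequencies. -/
theorem shellSymbol_eq_integral (φ : 𝓢(ℝ, ℂ)) (t : ℝ) (z : V × V) :
    shellSymbol φ t z = ∫ τ, Real.fourierChar (τ * (-(t * ‖z.1‖ ^ 2) + -(t * ‖z.2‖ ^ 2))) •
      (Real.fourierChar (τ * t) • 𝓕 φ τ) := by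
  have hinv : φ = 𝓕⁻ (𝓕 φ) := (FourierTransform.fourierInv_fourier_eq φ).symm
  calc shellSymbol φ t z = 𝓕⁻ ⇑(𝓕 φ : 𝓢(ℝ, ℂ)) (t * (1 - ‖z.1‖ ^ 2 - ‖z.2‖ ^ 2)) := by
        rw [shellSymbol, ← SchwartzMap.fourierInv_coe, ← hinv]
    _ = _ := by
        simp only [Real.fourierInv_eq, smul_smul, ← AddChar.map_add_eq_mul]
        congr! 4
        simp
        ring

end ShellSymbol

section Shell

variable {V : Type*} [NormedAddCommGroup V] [InnerProductSpace ℝ V] [FiniteDimensional ℝ V]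
  [MeasurableSpace V] [BorelSpace V] {φ : 𝓢(ℝ, ℂ)} {b t : ℝ}

theorem volume_norm_sq_mem_Icc_le (hn : 2 ≤ Module.finrank ℝ V) {s s' : ℝ} (hs' : s' ≤ 1) :
    volume {u : V | ‖u‖ ^ 2 ∈ Icc s s'} ≤
      ENNReal.ofReal (Module.finrank ℝ V * (s' - s)) * volume (Metric.ball (0 : V) 1) := by
  have : Nontrivial V := Module.finrank_pos_iff (R := ℝ) |>.1 (by omega)
  rcases lt_or_ge s' (max s 0) with hlt | hle
  · have hempty : {u : V | ‖u‖ ^ 2 ∈ Icc s s'} = ∅ := by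
      refine eq_empty_of_forall_notMem fun u hu => hlt.not_ge ?_
      exact max_le (hu.1.trans hu.2) ((sq_nonneg _).trans hu.2)
    rw [hempty, measure_empty]
    exact zero_le
  have hs0 : 0 ≤ max s 0 := le_max_right _ _
  have hsqrt : √(max s 0) ≤ √s' := Real.sqrt_le_sqrt hle
  have hsub : {u : V | ‖u‖ ^ 2 ∈ Icc s s'} ⊆
      Metric.closedBall 0 √s' \ Metric.ball 0 √(max s 0) := by
    intro u hu
    rw [Set.mem_sdiff, mem_closedBall_zero_iff, mem_ball_zero_iff, not_lt]
    exact ⟨Real.le_sqrt_of_sq_le hu.2,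
      Real.sqrt_le_iff.2 ⟨norm_nonneg _, max_le hu.1 (sq_nonneg _)⟩⟩
  refine (measure_mono hsub).trans ?_
  rw [measure_sdiff (Metric.ball_subset_closedBall.trans
      (Metric.closedBall_subset_closedBall hsqrt)) measurableSet_ball.nullMeasurableSet
      measure_ball_lt_top.ne,
    Measure.addHaar_closedBall _ _ (Real.sqrt_nonneg _),
    Measure.addHaar_ball _ _ (Real.sqrt_nonneg _),
    ← ENNReal.sub_mul (fun _ _ => measure_ball_lt_top.ne), ← ENNReal.ofReal_sub _ (by positivity)]
  gcongr
  refine (pow_sub_pow_le_mul_sq_sub_sq (Real.sqrt_nonneg _) hsqrt (Real.sqrt_le_one.2 hs')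
    hn).trans ?_
  rw [Real.sq_sqrt (hs0.trans hle), Real.sq_sqrt hs0]
  gcongr
  exact le_max_left _ _



theorem lintegral_enorm_shellSymbol_sub_sq_le (hn : 2 ≤ Module.finrank ℝ V)
    (hφ : Function.support φ ⊆ Icc 0 b) (ht : 0 < t) (ζ : V) :
    ∫⁻ ξ, ‖shellSymbol φ t (ξ, ζ - ξ)‖ₑ ^ (2 : ℝ) ≤
      ENNReal.ofReal (SchwartzMap.seminorm ℝ 0 0 φ) ^ (2 : ℝ) *
        (ENNReal.ofReal (Module.finrank ℝ V * (b / t / 2)) * volume (Metric.ball (0 : V) 1)) := by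
  set M : ℝ≥0∞ := ENNReal.ofReal (SchwartzMap.seminorm ℝ 0 0 φ) ^ (2 : ℝ)
  set c : ℝ := (1 - ‖ζ‖ ^ 2 / 2) / 2
  set S : Set V := {u | ‖u‖ ^ 2 ∈ Icc (c - b / t / 2) c}
  have hS : MeasurableSet S := measurableSet_Icc.preimage (by fun_prop)
  have hpt (ξ : V) : ‖shellSymbol φ t (ξ, ζ - ξ)‖ₑ ^ (2 : ℝ) ≤
      S.indicator (fun _ => M) (ξ - (1 / 2 : ℝ) • ζ) := by
    by_cases hξ : ξ - (1 / 2 : ℝ) • ζ ∈ S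
    · rw [indicator_of_mem hξ, ← ofReal_norm]
      exact ENNReal.rpow_le_rpow (ENNReal.ofReal_le_ofReal (norm_shellSymbol_le φ t _)) zero_le_two
    · suffices h : shellSymbol φ t (ξ, ζ - ξ) = 0 by simp [h]
      contrapose! hξ
      obtain ⟨hlo, hhi⟩ := hφ hξ
      rw [mul_nonneg_iff_of_pos_left ht] at hlo
      rw [← le_div_iff₀' ht] at hhi
      have hpar := norm_sq_add_norm_sub_sq ξ ζ
      constructor <;> simp only [c] at * <;> linarith
  calc ∫⁻ ξ, ‖shellSymbol φ t (ξ, ζ - ξ)‖ₑ ^ (2 : ℝ)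
      ≤ ∫⁻ ξ, S.indicator (fun _ => M) (ξ - (1 / 2 : ℝ) • ζ) := lintegral_mono hpt
    _ = M * volume S := by
        rw [lintegral_sub_right_eq_self (S.indicator fun _ => M), lintegral_indicator_const hS]
    _ ≤ _ := by
        gcongr
        refine (volume_norm_sq_mem_Icc_le hn ?_).trans_eq (by rw [sub_sub_cancel])
        linarith [sq_nonneg ‖ζ‖, show c = (1 - ‖ζ‖ ^ 2 / 2) / 2 from rfl]

theorem exists_lintegral_enorm_shellSymbol_sub_sq_le (hn : 2 ≤ Module.finrank ℝ V)
    (hφ : Function.support φ ⊆ Icc 0 b) :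
    ∃ K ≠ (∞ : ℝ≥0∞), ∀ t : ℝ, 0 < t → ∀ ζ : V,
      ∫⁻ ξ, ‖shellSymbol φ t (ξ, ζ - ξ)‖ₑ ^ (2 : ℝ) ≤
        (K * ENNReal.ofReal t ^ (-(1 / 2) : ℝ)) ^ (2 : ℝ) := by
  set A : ℝ≥0∞ := ENNReal.ofReal (SchwartzMap.seminorm ℝ 0 0 φ) ^ (2 : ℝ) *
    (ENNReal.ofReal (Module.finrank ℝ V * (b / 2)) * volume (Metric.ball (0 : V) 1)) with hA
  have hAtop : A ≠ ∞ := by finiteness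
  refine ⟨A ^ (1 / 2 : ℝ), by finiteness, fun t ht ζ => ?_⟩
  refine (lintegral_enorm_shellSymbol_sub_sq_le hn hφ ht ζ).trans_eq ?_
  rw [ENNReal.mul_rpow_of_nonneg _ _ zero_le_two, ← ENNReal.rpow_mul, ← ENNReal.rpow_mul,
    show (1 / 2 : ℝ) * 2 = 1 by norm_num, show -(1 / 2 : ℝ) * 2 = -1 by norm_num,
    ENNReal.rpow_one, ENNReal.rpow_neg_one, ← ENNReal.ofReal_inv_of_pos ht, hA,
    show (Module.finrank ℝ V : ℝ) * (b / t / 2) = Module.finrank ℝ V * (b / 2) * t⁻¹ by ring,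
    ENNReal.ofReal_mul' (by positivity)]
  ring

theorem exists_eLpNorm'_bilinearMultiplier_shellSymbol_le_of_two_le
    (hn : 2 ≤ Module.finrank ℝ V) (hφ : Function.support φ ⊆ Icc 0 b) {s : ℝ} (hs : 2 ≤ s) :
    ∃ C ≠ (∞ : ℝ≥0∞), ∀ t : ℝ, 0 < t → ∀ U W : V → ℂ, Integrable U → Integrable W →
      MemLp U 2 → MemLp W 2 → eLpNorm' (bilinearMultiplier (shellSymbol φ t) U W) s volume ≤
        C * ENNReal.ofReal t ^ (-(1 / 2) : ℝ) *
          (eLpNorm' U 2 volume * eLpNorm' W 2 volume) := by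
  obtain ⟨K, hK, hKb⟩ := exists_lintegral_enorm_shellSymbol_sub_sq_le hn hφ
  have hexp : 0 ≤ 1 / 2 - 1 / s := sub_nonneg.2 (one_div_le_one_div_of_le two_pos hs)
  refine ⟨volume (Metric.closedBall (0 : V) 2) ^ (1 / 2 - 1 / s) * K, ?_, ?_⟩
  · have hball : volume (Metric.closedBall (0 : V) 2) ≠ ∞ := measure_closedBall_lt_top.ne
    finiteness
  intro t ht U W hU hW hU2 hW2
  have ht0 : ENNReal.ofReal t ≠ 0 := by simpa using ht
  refine (eLpNorm'_bilinearMultiplier_le_of_two_le (continuous_shellSymbol φ t).measurable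
    (norm_shellSymbol_le φ t) hU hW hU2 hW2
    (ENNReal.mul_ne_top hK (ENNReal.rpow_ne_top_of_ne_zero ht0 ENNReal.ofReal_ne_top)) (hKb t ht)
    (fun z hz => shellSymbol_eq_zero_of_add_notMem hφ ht hz) hs).trans_eq ?_
  ring

theorem eLpNorm'_one_bilinearMultiplier_shellSymbol_le (φ : 𝓢(ℝ, ℂ)) (t : ℝ) {U W : V → ℂ}
    (hU : Integrable U) (hW : Integrable W) (hU2 : MemLp U 2) (hW2 : MemLp W 2) :
    eLpNorm' (bilinearMultiplier (shellSymbol φ t) U W) 1 volume ≤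
      (∫⁻ τ, ‖𝓕 φ τ‖ₑ) * (eLpNorm' U 2 volume * eLpNorm' W 2 volume) := by
  simpa only [enorm_circle_smul] using eLpNorm'_one_bilinearMultiplier_le
    (integrable_fourierChar_smul (by fun_prop) (𝓕 φ).integrable)
    (a := fun ξ => -(t * ‖ξ‖ ^ 2)) (by fun_prop) (shellSymbol_eq_integral φ t) hU hW hU2 hW2

theorem exists_eLpNorm'_bilinearMultiplier_shellSymbol_le_of_le_two
    (hn : 2 ≤ Module.finrank ℝ V) (hφ : Function.support φ ⊆ Icc 0 b) {s : ℝ} (hs1 : 1 ≤ s)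
    (hs2 : s ≤ 2) :
    ∃ C ≠ (∞ : ℝ≥0∞), ∀ t : ℝ, 0 < t → ∀ U W : V → ℂ, Integrable U → Integrable W →
      MemLp U 2 → MemLp W 2 → eLpNorm' (bilinearMultiplier (shellSymbol φ t) U W) s volume ≤
        C * ENNReal.ofReal t ^ (-(1 - 1 / s)) *
          (eLpNorm' U 2 volume * eLpNorm' W 2 volume) := by
  obtain ⟨K, hK, hKb⟩ :=
    exists_eLpNorm'_bilinearMultiplier_shellSymbol_le_of_two_le hn hφ le_rfl
  have hs0 : 0 < s := by linarith
  have hexp1 : 0 ≤ 2 / s - 1 := by rw [sub_nonneg, le_div_iff₀ hs0]; linarith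
  have hexp2 : 0 ≤ 2 - 2 / s := by rw [sub_nonneg, div_le_iff₀ hs0]; linarith
  set k := ∫⁻ τ, ‖𝓕 φ τ‖ₑ
  have hk : k ≠ ∞ := (𝓕 φ).integrable.2.ne
  refine ⟨k ^ (2 / s - 1) * K ^ (2 - 2 / s), by finiteness, fun t ht U W hU hW hU2 hW2 => ?_⟩
  have hcont := continuous_bilinearMultiplier (integrable_symbol_mul
    (continuous_shellSymbol φ t).measurable (norm_shellSymbol_le φ t) hU hW)
  have hone := eLpNorm'_one_bilinearMultiplier_shellSymbol_le φ t hU hW hU2 hW2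
  have htwo := hKb t ht U W hU hW hU2 hW2
  set N := eLpNorm' U 2 volume * eLpNorm' W 2 volume
  calc eLpNorm' (bilinearMultiplier (shellSymbol φ t) U W) s volume
      ≤ (k * N) ^ (2 / s - 1) * (K * ENNReal.ofReal t ^ (-(1 / 2) : ℝ) * N) ^ (2 - 2 / s) := by
        refine (eLpNorm'_le_interpolate_one_two hcont.aestronglyMeasurable hs1 hs2).trans ?_
        gcongr
    _ = k ^ (2 / s - 1) * K ^ (2 - 2 / s) * ENNReal.ofReal t ^ (-(1 / 2) * (2 - 2 / s)) *
          (N ^ (2 / s - 1) * N ^ (2 - 2 / s)) := by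
        simp only [ENNReal.mul_rpow_of_nonneg _ _ hexp1, ENNReal.mul_rpow_of_nonneg _ _ hexp2,
          ← ENNReal.rpow_mul]
        ring
    _ = k ^ (2 / s - 1) * K ^ (2 - 2 / s) * ENNReal.ofReal t ^ (-(1 - 1 / s)) * N := by
        rw [← ENNReal.rpow_add_of_nonneg _ _ hexp1 hexp2,
          show 2 / s - 1 + (2 - 2 / s) = 1 by ring, ENNReal.rpow_one,
          show -(1 / 2) * (2 - 2 / s) = -(1 - 1 / s) by ring]

/-- The power of the thickness gained in the `L² × L² → L^s` bound for a shell symbol. -/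
noncomputable def shellGain (s : ℝ) : ℝ := min (1 / 2) (1 - 1 / s)

theorem shellGain_of_two_le {s : ℝ} (hs : 2 ≤ s) : shellGain s = 1 / 2 := by
  have := one_div_le_one_div_of_le two_pos hs
  exact min_eq_left (by linarith)

theorem shellGain_of_le_two {s : ℝ} (hs1 : 1 ≤ s) (hs2 : s ≤ 2) : shellGain s = 1 - 1 / s := by
  have := one_div_le_one_div_of_le (by linarith) hs2
  exact min_eq_right (by linarith)

theorem exists_eLpNorm'_bilinearMultiplier_shellSymbol_le (hn : 2 ≤ Module.finrank ℝ V)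
    (hφ : Function.support φ ⊆ Icc 0 b) {s : ℝ} (hs : 1 ≤ s) :
    ∃ C ≠ (∞ : ℝ≥0∞), ∀ t : ℝ, 0 < t → ∀ U W : V → ℂ, Integrable U → Integrable W →
      MemLp U 2 → MemLp W 2 → eLpNorm' (bilinearMultiplier (shellSymbol φ t) U W) s volume ≤
        C * ENNReal.ofReal t ^ (-shellGain s) *
          (eLpNorm' U 2 volume * eLpNorm' W 2 volume) := by
  rcases le_total s 2 with hs2 | hs2
  · rw [shellGain_of_le_two hs hs2]
    exact exists_eLpNorm'_bilinearMultiplier_shellSymbol_le_of_le_two hn hφ hs hs2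
  · rw [shellGain_of_two_le hs2]
    exact exists_eLpNorm'_bilinearMultiplier_shellSymbol_le_of_two_le hn hφ hs2

end Shell

section Localization

theorem eLpNorm'_le_of_support_subset {α E : Type*} [MeasurableSpace α] [NormedAddCommGroup E]
    {μ : Measure α} {f : α → E} (hf : AEStronglyMeasurable f μ) {S : Set α}
    (hS : Function.support f ⊆ S) {p q : ℝ} (hp : 0 < p) (hpq : p ≤ q) :
    eLpNorm' f p μ ≤ eLpNorm' f q μ * μ S ^ (1 / p - 1 / q) := by
  have hsupp : Function.support (fun x => ‖f x‖ₑ ^ p) ⊆ S := by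
    refine fun x hx => hS fun h => hx ?_
    simp [h, hp]
  calc eLpNorm' f p μ = eLpNorm' f p (μ.restrict S) := by
        rw [eLpNorm', eLpNorm', setLIntegral_eq_of_support_subset hsupp]
    _ ≤ eLpNorm' f q (μ.restrict S) * μ.restrict S univ ^ (1 / p - 1 / q) :=
        eLpNorm'_le_eLpNorm'_mul_rpow_measure_univ hp hpq hf.restrict
    _ ≤ eLpNorm' f q μ * μ S ^ (1 / p - 1 / q) := by
        rw [Measure.restrict_apply_univ]
        gcongr ?_ * _
        exact eLpNorm'_mono_measure f Measure.restrict_le_self (hp.le.trans hpq)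

/-- The power of `ρ` lost in passing from `L^p` to `L²` on a ball of radius `ρ` of an
`n`-dimensional space, for functions with frequencies in the unit ball. -/
noncomputable def ballLoss (n : ℕ) (p : ℝ) : ℝ := n * max 0 (1 / 2 - 1 / p)

theorem ballLoss_nonneg (n : ℕ) (p : ℝ) : 0 ≤ ballLoss n p :=
  mul_nonneg n.cast_nonneg (le_max_left _ _)

theorem ballLoss_of_le_two (n : ℕ) {p : ℝ} (hp : 0 < p) (hp2 : p ≤ 2) : ballLoss n p = 0 := by
  have := one_div_le_one_div_of_le hp hp2
  rw [ballLoss, max_eq_left (by linarith), mul_zero]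

theorem ballLoss_of_two_le (n : ℕ) {p : ℝ} (hp : 2 ≤ p) : ballLoss n p = n * (1 / 2 - 1 / p) := by
  have := one_div_le_one_div_of_le two_pos hp
  rw [ballLoss, max_eq_right (by linarith)]

variable {V : Type*} [NormedAddCommGroup V] [InnerProductSpace ℝ V] [FiniteDimensional ℝ V]
  [MeasurableSpace V] [BorelSpace V] {p : ℝ}

theorem eLpNorm'_indicator_fourier_le_of_two_le (hp : 2 ≤ p) {f : V → ℂ} (hf : Integrable f)
    (hf2 : MemLp f 2) {a : V} {ρ : ℝ} (hρ : 0 < ρ)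
    (hsupp : Function.support f ⊆ Metric.ball a ρ) (B : Set V) :
    eLpNorm' (B.indicator (𝓕 f)) 2 volume ≤ volume (Metric.ball (0 : V) 1) ^ (1 / 2 - 1 / p) *
      ENNReal.ofReal ρ ^ ballLoss (Module.finrank ℝ V) p * eLpNorm' f p volume := by
  calc eLpNorm' (B.indicator (𝓕 f)) 2 volume ≤ eLpNorm' f 2 volume := by
        rw [← eLpNorm'_fourier_two hf hf2]
        exact eLpNorm'_mono_enorm_ae zero_le_two
          (.of_forall fun x => enorm_indicator_le_enorm_self _ _)
    _ ≤ eLpNorm' f p volume * volume (Metric.ball a ρ) ^ (1 / 2 - 1 / p) :=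
        eLpNorm'_le_of_support_subset hf.1 hsupp two_pos hp
    _ = _ := by
        rw [Measure.addHaar_ball_of_pos _ _ hρ, ballLoss_of_two_le _ hp,
          ENNReal.mul_rpow_of_ne_top ENNReal.ofReal_ne_top measure_ball_lt_top.ne,
          ENNReal.ofReal_pow hρ.le, ← ENNReal.rpow_natCast, ← ENNReal.rpow_mul]
        ring

theorem exists_eLpNorm'_indicator_fourier_le (hp : 1 < p) :
    ∃ C ≠ (∞ : ℝ≥0∞), ∀ ρ : ℝ, 1 ≤ ρ → ∀ (a : V) (f : V → ℂ), Integrable f → MemLp f 2 →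
      Function.support f ⊆ Metric.ball a ρ →
      eLpNorm' ((Metric.closedBall (0 : V) 1).indicator (𝓕 f)) 2 volume ≤
        C * ENNReal.ofReal ρ ^ ballLoss (Module.finrank ℝ V) p * eLpNorm' f p volume := by
  rcases le_total p 2 with hp2 | hp2
  · refine ⟨volume (Metric.closedBall (0 : V) 1) ^ (1 / p - 1 / 2), ENNReal.rpow_ne_top_of_ne_zero
      (Metric.measure_closedBall_pos _ _ one_pos).ne' measure_closedBall_lt_top.ne, ?_⟩
    intro ρ _ a f hf _ _
    rw [ballLoss_of_le_two _ (by linarith) hp2, ENNReal.rpow_zero, mul_one]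
    exact eLpNorm'_indicator_fourier_le_of_le_two hp hp2 hf measurableSet_closedBall
      measure_closedBall_lt_top.ne
  · refine ⟨volume (Metric.ball (0 : V) 1) ^ (1 / 2 - 1 / p), ENNReal.rpow_ne_top_of_ne_zero
      (Metric.measure_ball_pos _ _ one_pos).ne' measure_ball_lt_top.ne, ?_⟩
    intro ρ hρ a f hf hf2 hsupp
    exact eLpNorm'_indicator_fourier_le_of_two_le hp2 hf hf2 (by linarith) hsupp _

theorem bilinearMultiplier_indicator {m : V × V → ℂ} {B : Set V}
    (hm : Function.support m ⊆ B ×ˢ B) (U W : V → ℂ) :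
    bilinearMultiplier m (B.indicator U) (B.indicator W) = bilinearMultiplier m U W := by
  ext x
  refine integral_congr_ae (.of_forall fun z => ?_)
  by_cases hz : m z = 0
  · simp only [hz, zero_mul]
  · simp only [indicator_of_mem (hm hz).1, indicator_of_mem (hm hz).2]

theorem exists_eLpNorm'_bilinearMultiplier_shellSymbol_fourier_le_of_support_subset_ball
    (hn : 2 ≤ Module.finrank ℝ V) {φ : 𝓢(ℝ, ℂ)} {b : ℝ} (hφ : Function.support φ ⊆ Icc 0 b)
    {q r : ℝ} (hp : 1 < p) (hq : 1 < q) (hr : 1 ≤ r) :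
    ∃ C ≠ (∞ : ℝ≥0∞), ∀ t : ℝ, 0 < t → ∀ ρ : ℝ, 1 ≤ ρ → ∀ (a : V) (f g : V → ℂ),
      Integrable f → Integrable g → MemLp f 2 → MemLp g 2 →
      Function.support f ⊆ Metric.ball a ρ → Function.support g ⊆ Metric.ball a ρ →
      eLpNorm' (bilinearMultiplier (shellSymbol φ t) (𝓕 f) (𝓕 g)) r volume ≤
        C * (ENNReal.ofReal t ^ (-shellGain r) * ENNReal.ofReal ρ ^
          (ballLoss (Module.finrank ℝ V) p + ballLoss (Module.finrank ℝ V) q)) *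
          (eLpNorm' f p volume * eLpNorm' g q volume) := by
  obtain ⟨C, hC, hCb⟩ := exists_eLpNorm'_bilinearMultiplier_shellSymbol_le hn hφ hr
  obtain ⟨C₁, hC₁, hCb₁⟩ := exists_eLpNorm'_indicator_fourier_le (V := V) hp
  obtain ⟨C₂, hC₂, hCb₂⟩ := exists_eLpNorm'_indicator_fourier_le (V := V) hq
  refine ⟨C * (C₁ * C₂), by finiteness, fun t ht ρ hρ a f g hf hg hf2 hg2 hfs hgs => ?_⟩
  have hmem {f : V → ℂ} (hf : Integrable f) (s : ℝ≥0∞) :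
      MemLp ((Metric.closedBall (0 : V) 1).indicator (𝓕 f)) s :=
    memLp_indicator_fourier hf measurableSet_closedBall measure_closedBall_lt_top.ne s
  have hsupp : Function.support (shellSymbol φ t : V × V → ℂ) ⊆
      Metric.closedBall 0 1 ×ˢ Metric.closedBall 0 1 := by
    rw [closedBall_prod_same]
    exact fun z hz => mem_closedBall_of_shellSymbol_ne_zero hφ ht hz
  rw [← bilinearMultiplier_indicator hsupp]
  refine (hCb t ht _ _ (memLp_one_iff_integrable.1 (hmem hf 1))
    (memLp_one_iff_integrable.1 (hmem hg 1)) (hmem hf 2) (hmem hg 2)).trans ?_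
  grw [hCb₁ ρ hρ a f hf hf2 hfs, hCb₂ ρ hρ a g hg hg2 hgs,
    ENNReal.rpow_add_of_nonneg _ _ (ballLoss_nonneg _ _) (ballLoss_nonneg _ _)]
  exact le_of_eq (by ring)

end Localization

section Kernel

theorem exists_norm_iteratedFDeriv_le_of_isCompact {E F : Type*} [NormedAddCommGroup E]
    [NormedSpace ℝ E] [NormedAddCommGroup F] [NormedSpace ℝ F] {h : E → F} {N : ℕ}
    (hh : ContDiff ℝ N h) {K : Set E} (hK : IsCompact K) :
    ∃ A : ℝ, ∀ i ≤ N, ∀ z ∈ K, ‖iteratedFDeriv ℝ i h z‖ ≤ A := by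
  have hcont : Continuous fun z => ∑ i ∈ Finset.range (N + 1), ‖iteratedFDeriv ℝ i h z‖ :=
    continuous_finsetSum _ fun i hi => (hh.continuous_iteratedFDeriv
      (by exact_mod_cast Finset.mem_range_succ_iff.1 hi)).norm
  obtain ⟨A, hA⟩ := hK.bddAbove_image hcont.continuousOn
  refine ⟨A, fun i hi z hz => le_trans ?_ (hA (mem_image_of_mem _ hz))⟩
  exact Finset.single_le_sum (f := fun i => ‖iteratedFDeriv ℝ i h z‖)
    (fun _ _ => norm_nonneg _) (Finset.mem_range_succ_iff.2 hi)

theorem exists_norm_iteratedFDeriv_comp_mul_le {E : Type*} [NormedAddCommGroup E]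
    [NormedSpace ℝ E] (φ : 𝓢(ℝ, ℂ)) {h : E → ℝ} {N : ℕ} (hh : ContDiff ℝ N h) {K : Set E}
    (hK : IsCompact K) :
    ∃ C : ℝ, 0 ≤ C ∧ ∀ t : ℝ, 1 ≤ t → ∀ i ≤ N, ∀ z ∈ K,
      ‖iteratedFDeriv ℝ i (fun z => φ (t * h z)) z‖ ≤ C * t ^ N := by
  obtain ⟨A, hA⟩ := exists_norm_iteratedFDeriv_le_of_isCompact hh hK
  set A' : ℝ := max 1 A
  have hA' : 1 ≤ A' := le_max_left _ _
  set S : ℝ := (Finset.Iic (0, N)).sup (fun k => SchwartzMap.seminorm ℝ k.1 k.2) φ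
  have hS (i : ℕ) (hi : i ≤ N) (u : ℝ) : ‖iteratedFDeriv ℝ i φ u‖ ≤ S := by
    simpa using SchwartzMap.one_add_le_sup_seminorm_apply (𝕜 := ℝ) (m := (0, N)) le_rfl hi φ u
  have hS0 : 0 ≤ S := (norm_nonneg _).trans (hS 0 N.zero_le 0)
  refine ⟨N.factorial * S * A' ^ N, by positivity, fun t ht i hi z hz => ?_⟩
  have ht0 : 0 ≤ t := by linarith
  have hhi : ContDiff ℝ i h := hh.of_le (by exact_mod_cast hi)
  have hinner (j : ℕ) (hj : 1 ≤ j) (hji : j ≤ i) :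
      ‖iteratedFDeriv ℝ j (fun z => t * h z) z‖ ≤ (t * A') ^ j := by
    have hhj : ContDiff ℝ j h := hhi.of_le (by exact_mod_cast hji)
    calc ‖iteratedFDeriv ℝ j (fun z => t * h z) z‖ = t * ‖iteratedFDeriv ℝ j h z‖ := by
          rw [show (fun z => t * h z) = t • h from rfl,
            iteratedFDeriv_const_smul_apply hhj.contDiffAt, norm_smul, Real.norm_of_nonneg ht0]
      _ ≤ t * A' := by
          gcongr
          exact (hA j (hji.trans hi) z hz).trans (le_max_right _ _)
      _ ≤ (t * A') ^ j := le_self_pow₀ (one_le_mul_of_one_le_of_one_le ht hA') (by omega)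
  calc ‖iteratedFDeriv ℝ i (fun z => φ (t * h z)) z‖ ≤ i.factorial * S * (t * A') ^ i :=
        norm_iteratedFDeriv_comp_le (φ.smooth i) (contDiff_const.mul hhi) le_rfl z
          (fun j hj => hS j (hj.trans hi) _) hinner
    _ ≤ N.factorial * S * (t * A') ^ N := by
        gcongr
        exact one_le_mul_of_one_le_of_one_le ht hA'
    _ = N.factorial * S * A' ^ N * t ^ N := by ring

variable {V : Type*} [NormedAddCommGroup V] [InnerProductSpace ℝ V]

variable (V) in
/-- The Euclidean inner product on `V × V`, whose norm as a normed space is the maximum norm. -/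
noncomputable def prodInner : V × V →L[ℝ] V × V →L[ℝ] ℝ :=
  (innerSL ℝ).bilinearComp (.fst ℝ V V) (.fst ℝ V V) +
    (innerSL ℝ).bilinearComp (.snd ℝ V V) (.snd ℝ V V)

theorem prodInner_apply (v w : V × V) : prodInner V v w = ⟪v.1, w.1⟫ + ⟪v.2, w.2⟫ := rfl

theorem exists_inner_eq_norm (x : V) : ∃ v : V, ‖v‖ ≤ 1 ∧ ⟪v, x⟫ = ‖x‖ := by
  refine ⟨‖x‖⁻¹ • x, ?_, ?_⟩
  · rw [norm_smul, norm_inv, norm_norm]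
    exact inv_mul_le_one
  · rw [real_inner_smul_left, real_inner_self_eq_norm_mul_norm, ← mul_assoc]
    exact inv_mul_mul_self _

theorem exists_prodInner_eq_norm (w : V × V) : ∃ v, ‖v‖ ≤ 1 ∧ prodInner V v w = ‖w‖ := by
  obtain ⟨v₁, hv₁, hvw₁⟩ := exists_inner_eq_norm w.1
  obtain ⟨v₂, hv₂, hvw₂⟩ := exists_inner_eq_norm w.2
  rcases le_total ‖w.1‖ ‖w.2‖ with h | h
  · refine ⟨(0, v₂), by simpa [Prod.norm_def] using hv₂, ?_⟩
    simp [prodInner_apply, hvw₂, Prod.norm_def, h]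
  · refine ⟨(v₁, 0), by simpa [Prod.norm_def] using hv₁, ?_⟩
    simp [prodInner_apply, hvw₁, Prod.norm_def, h]

variable [FiniteDimensional ℝ V] [MeasurableSpace V] [BorelSpace V]

instance isAddHaarMeasure_volume_prod : (volume : Measure (V × V)).IsAddHaarMeasure :=
  inferInstanceAs ((volume : Measure V).prod volume).IsAddHaarMeasure

/-- The convolution kernel on `V × V` of the bilinear multiplier operator with symbol `m`, i.e.
the inverse Fourier transform of `m`. -/
noncomputable def bilinearKernel (m : V × V → ℂ) (w : V × V) : ℂ :=
  ∫ z : V × V, Real.fourierChar (⟪w.1, z.1⟫ + ⟪w.2, z.2⟫) • m z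

theorem continuous_bilinearKernel {m : V × V → ℂ} (hm : Integrable m) :
    Continuous (bilinearKernel m) :=
  continuous_integral_fourierChar_smul (by fun_prop) hm

theorem pow_norm_mul_norm_bilinearKernel_le {m : V × V → ℂ} {N : ℕ} (hm : ContDiff ℝ N m)
    (hint : ∀ i ≤ N, Integrable (iteratedFDeriv ℝ i m)) (w : V × V) :
    ‖w‖ ^ N * ‖bilinearKernel m w‖ ≤
      2 ^ N * ∑ i ∈ Finset.range (N + 1), ∫ z, ‖iteratedFDeriv ℝ i m z‖ := by
  obtain ⟨v, hv, hvw⟩ := exists_prodInner_eq_norm (-w)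
  have hK : bilinearKernel m w =
      VectorFourier.fourierIntegral Real.fourierChar volume (prodInner V).toLinearMap₁₂ m (-w) := by
    refine integral_congr_ae (.of_forall fun z => ?_)
    simp [prodInner_apply, real_inner_comm, add_comm]
  have hdecay := VectorFourier.pow_mul_norm_iteratedFDeriv_fourierIntegral_le (prodInner V)
    (K := 0) hm (fun k i hk hi => by
      obtain rfl : k = 0 := by simpa using hk
      simpa using (hint i (by exact_mod_cast hi)).norm) (k := 0) (n := N) le_rfl le_rfl v (-w)
  rw [hvw, norm_iteratedFDeriv_zero, ← hK, norm_neg, abs_norm] at hdecay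
  refine hdecay.trans ?_
  simp only [CharP.cast_eq_zero, mul_zero, zero_add, pow_zero, mul_one,
    Finset.range_one, Finset.singleton_product, Finset.sum_map, Function.Embedding.coeFn_mk,
    one_mul]
  gcongr
  · exact Finset.sum_nonneg fun i _ => integral_nonneg fun z => norm_nonneg (iteratedFDeriv ℝ i m z)
  · exact mul_le_of_le_one_left (by positivity) (pow_le_one₀ (norm_nonneg v) hv)

theorem fourierChar_smul_fourier_eq_integral (f : V → ℂ) (x ξ : V) :
    Real.fourierChar ⟪x, ξ⟫ • 𝓕 f ξ = ∫ y, Real.fourierChar ⟪y, ξ⟫ • f (x - y) := by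
  rw [← integral_sub_left_eq_self _ _ x, Real.fourier_eq]
  simp only [Circle.smul_def, ← integral_smul, sub_sub_cancel]
  simp only [← Circle.smul_def, smul_smul, ← AddChar.map_add_eq_mul, inner_sub_left]
  simp only [sub_eq_add_neg]

theorem fourierChar_smul_mul_fourier_mul_fourier (c : ℂ) (f g : V → ℂ) (x : V) (z : V × V) :
    Real.fourierChar ⟪x, z.1 + z.2⟫ • (c * 𝓕 f z.1 * 𝓕 g z.2) =
      ∫ w : V × V, Real.fourierChar (⟪w.1, z.1⟫ + ⟪w.2, z.2⟫) •
        (f (x - w.1) * g (x - w.2) * c) := by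
  calc Real.fourierChar ⟪x, z.1 + z.2⟫ • (c * 𝓕 f z.1 * 𝓕 g z.2)
      = (Real.fourierChar ⟪x, z.1⟫ • 𝓕 f z.1) * (Real.fourierChar ⟪x, z.2⟫ • 𝓕 g z.2) * c := by
        simp only [inner_add_right, AddChar.map_add_eq_mul, Circle.smul_def, Circle.coe_mul,
          smul_eq_mul]
        ring
    _ = ∫ w : V × V, (Real.fourierChar ⟪w.1, z.1⟫ • f (x - w.1)) *
          (Real.fourierChar ⟪w.2, z.2⟫ • g (x - w.2)) * c := by
        rw [fourierChar_smul_fourier_eq_integral, fourierChar_smul_fourier_eq_integral,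
          ← integral_prod_mul, ← integral_mul_const]
        rfl
    _ = _ := by
        simp only [AddChar.map_add_eq_mul, Circle.smul_def, Circle.coe_mul, smul_eq_mul]
        congr! 2
        ring

theorem bilinearMultiplier_fourier_eq_integral_kernel {m : V × V → ℂ} (hm : Integrable m)
    {f g : V → ℂ} (hf : Integrable f) (hg : Integrable g) (x : V) :
    bilinearMultiplier m (𝓕 f) (𝓕 g) x =
      ∫ w : V × V, bilinearKernel m w * (f (x - w.1) * g (x - w.2)) := by
  have hfg : Integrable fun w : V × V => f (x - w.1) * g (x - w.2) :=
    (hf.comp_sub_left x).mul_prod (hg.comp_sub_left x)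
  have hint : Integrable (fun y : (V × V) × (V × V) =>
      Real.fourierChar (⟪y.1.1, y.2.1⟫ + ⟪y.1.2, y.2.2⟫) •
        (f (x - y.1.1) * g (x - y.1.2) * m y.2)) (volume.prod volume) :=
    integrable_fourierChar_smul (by fun_prop) (hfg.mul_prod hm)
  calc bilinearMultiplier m (𝓕 f) (𝓕 g) x
      = ∫ z : V × V, ∫ w : V × V, Real.fourierChar (⟪w.1, z.1⟫ + ⟪w.2, z.2⟫) •
          (f (x - w.1) * g (x - w.2) * m z) :=
        integral_congr_ae (.of_forall fun z => fourierChar_smul_mul_fourier_mul_fourier _ f g x z)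
    _ = ∫ w : V × V, ∫ z : V × V, Real.fourierChar (⟪w.1, z.1⟫ + ⟪w.2, z.2⟫) •
          (f (x - w.1) * g (x - w.2) * m z) := (integral_integral_swap hint).symm
    _ = ∫ w : V × V, bilinearKernel m w * (f (x - w.1) * g (x - w.2)) := by
        simp only [bilinearKernel, ← integral_mul_const, Circle.smul_def, smul_eq_mul]
        congr! 4
        ring

end Kernel

section ShellKernel

variable {V : Type*} [NormedAddCommGroup V] [InnerProductSpace ℝ V] {φ : 𝓢(ℝ, ℂ)} {b : ℝ}

theorem contDiff_one_sub_norm_sq_sub_norm_sq {N : WithTop ℕ∞} :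
    ContDiff ℝ N fun z : V × V => 1 - ‖z.1‖ ^ 2 - ‖z.2‖ ^ 2 :=
  (contDiff_const.sub (contDiff_fst.norm_sq ℝ)).sub (contDiff_snd.norm_sq ℝ)

theorem contDiff_shellSymbol (φ : 𝓢(ℝ, ℂ)) (t : ℝ) (N : ℕ) :
    ContDiff ℝ N (shellSymbol φ t : V × V → ℂ) :=
  (φ.smooth N).comp (contDiff_const.mul contDiff_one_sub_norm_sq_sub_norm_sq)

variable [FiniteDimensional ℝ V]

theorem hasCompactSupport_shellSymbol (hφ : Function.support φ ⊆ Icc 0 b) {t : ℝ} (ht : 0 < t) :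
    HasCompactSupport (shellSymbol φ t : V × V → ℂ) :=
  (isCompact_closedBall 0 1).of_isClosed_subset (isClosed_tsupport _)
    (tsupport_shellSymbol_subset hφ ht)

variable [MeasurableSpace V] [BorelSpace V]

theorem integrable_shellSymbol (hφ : Function.support φ ⊆ Icc 0 b) {t : ℝ} (ht : 0 < t) :
    Integrable (shellSymbol φ t : V × V → ℂ) :=
  (continuous_shellSymbol φ t).integrable_of_hasCompactSupport
    (hasCompactSupport_shellSymbol hφ ht)

theorem integrable_iteratedFDeriv_shellSymbol (hφ : Function.support φ ⊆ Icc 0 b) {t : ℝ}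
    (ht : 0 < t) (i : ℕ) : Integrable (iteratedFDeriv ℝ i (shellSymbol φ t : V × V → ℂ)) :=
  ((contDiff_shellSymbol φ t i).continuous_iteratedFDeriv le_rfl).integrable_of_hasCompactSupport
    ((hasCompactSupport_shellSymbol hφ ht).iteratedFDeriv i)

theorem exists_integral_norm_iteratedFDeriv_shellSymbol_le
    (hφ : Function.support φ ⊆ Icc 0 b) (N : ℕ) :
    ∃ C : ℝ, 0 ≤ C ∧ ∀ t : ℝ, 1 ≤ t → ∀ i ≤ N,
      ∫ z : V × V, ‖iteratedFDeriv ℝ i (shellSymbol φ t) z‖ ≤ C * t ^ N := by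
  set B : Set (V × V) := Metric.closedBall 0 1
  have hB : IsCompact B := isCompact_closedBall 0 1
  obtain ⟨C, hC, hCb⟩ := exists_norm_iteratedFDeriv_comp_mul_le φ (N := N)
    contDiff_one_sub_norm_sq_sub_norm_sq hB
  refine ⟨C * volume.real B, by positivity, fun t ht i hi => ?_⟩
  have ht0 : 0 < t := by linarith
  have hsupp : Function.support (iteratedFDeriv ℝ i (shellSymbol φ t)) ⊆ B :=
    (support_iteratedFDeriv_subset i).trans (tsupport_shellSymbol_subset hφ ht0)
  calc ∫ z : V × V, ‖iteratedFDeriv ℝ i (shellSymbol φ t) z‖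
      = ∫ z in B, ‖iteratedFDeriv ℝ i (shellSymbol φ t) z‖ :=
        (setIntegral_eq_integral_of_forall_compl_eq_zero fun z hz =>
          norm_eq_zero.2 (Function.notMem_support.1 fun h => hz (hsupp h))).symm
    _ ≤ ∫ _ in B, C * t ^ N :=
        setIntegral_mono_on (integrable_iteratedFDeriv_shellSymbol hφ ht0 i).norm.integrableOn
          (integrableOn_const hB.measure_lt_top.ne) hB.measurableSet
          fun z hz => hCb t ht i hi z hz
    _ = C * volume.real B * t ^ N := by
        rw [setIntegral_const, smul_eq_mul]
        ring

theorem exists_pow_norm_mul_norm_bilinearKernel_shellSymbol_le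
    (hφ : Function.support φ ⊆ Icc 0 b) (N : ℕ) :
    ∃ C : ℝ, 0 ≤ C ∧ ∀ t : ℝ, 1 ≤ t → ∀ w : V × V,
      ‖w‖ ^ N * ‖bilinearKernel (shellSymbol φ t) w‖ ≤ C * t ^ N := by
  obtain ⟨C, hC, hCb⟩ := exists_integral_norm_iteratedFDeriv_shellSymbol_le (V := V) hφ N
  refine ⟨2 ^ N * ((N + 1) * C), by positivity, fun t ht w => ?_⟩
  have ht0 : 0 < t := by linarith
  calc ‖w‖ ^ N * ‖bilinearKernel (shellSymbol φ t) w‖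
      ≤ 2 ^ N * ∑ i ∈ Finset.range (N + 1), ∫ z, ‖iteratedFDeriv ℝ i (shellSymbol φ t) z‖ :=
        pow_norm_mul_norm_bilinearKernel_le (contDiff_shellSymbol φ t N)
          (fun i _ => integrable_iteratedFDeriv_shellSymbol hφ ht0 i) w
    _ ≤ 2 ^ N * ∑ _ ∈ Finset.range (N + 1), C * t ^ N := by
        gcongr with i hi
        exact hCb t ht i (Finset.mem_range_succ_iff.1 hi)
    _ = 2 ^ N * ((N + 1) * C) * t ^ N := by
        rw [Finset.sum_const, Finset.card_range, nsmul_eq_mul]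
        push_cast
        ring

theorem mul_one_add_pow_le_of_pow_add_mul_le {x y C T : ℝ} {k d : ℕ} (hx : 1 ≤ x) (hy : 0 ≤ y)
    (hC : 0 ≤ C) (hT : T ≤ x ^ k) (h : x ^ (k + d) * y ≤ C * T) :
    y * (1 + x) ^ d ≤ C * 2 ^ d := by
  have hxk : 0 < x ^ k := by positivity
  have hxd : x ^ d * y ≤ C := by
    refine le_of_mul_le_mul_left ?_ hxk
    calc x ^ k * (x ^ d * y) = x ^ (k + d) * y := by ring
      _ ≤ C * T := h
      _ ≤ C * x ^ k := by gcongr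
      _ = x ^ k * C := mul_comm _ _
  calc y * (1 + x) ^ d ≤ y * (2 * x) ^ d := by gcongr; linarith
    _ = x ^ d * y * 2 ^ d := by ring
    _ ≤ C * 2 ^ d := by gcongr

/-- Beyond distance `t ^ (1 + ε)` each power of decay of the kernel beats its growth in `t`, so
enough of them leave an integrable bound uniform in `t`. -/
theorem exists_lintegral_enorm_bilinearKernel_shellSymbol_compl_ball_le
    (hφ : Function.support φ ⊆ Icc 0 b) {ε : ℝ} (hε : 0 < ε) :
    ∃ C ≠ (∞ : ℝ≥0∞), ∀ t : ℝ, 1 ≤ t →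
      ∫⁻ w in (Metric.ball (0 : V × V) (t ^ (1 + ε)))ᶜ, ‖bilinearKernel (shellSymbol φ t) w‖ₑ
        ≤ C := by
  set d := Module.finrank ℝ (V × V) + 1 with hd
  obtain ⟨k, hk⟩ := exists_nat_ge (d / ε)
  obtain ⟨C, hC, hCb⟩ :=
    exists_pow_norm_mul_norm_bilinearKernel_shellSymbol_le (V := V) hφ (k + d)
  have hfin : ∫⁻ w : V × V, ENNReal.ofReal ((1 + ‖w‖) ^ (-(d : ℝ))) ≠ ∞ :=
    (finite_integral_one_add_norm (by simp [hd])).ne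
  refine ⟨ENNReal.ofReal (C * 2 ^ d) * ∫⁻ w : V × V, ENNReal.ofReal ((1 + ‖w‖) ^ (-(d : ℝ))),
    by finiteness, fun t ht => ?_⟩
  rw [← lintegral_const_mul' _ _ ENNReal.ofReal_ne_top]
  refine (setLIntegral_mono' measurableSet_ball.compl fun w hw => ?_).trans
    (setLIntegral_le_lintegral _ _)
  rw [mem_compl_iff, mem_ball_zero_iff, not_lt] at hw
  have hone : 1 ≤ t ^ (1 + ε) := Real.one_le_rpow ht (by linarith)
  have hpow : t ^ (k + d) ≤ ‖w‖ ^ k := by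
    calc t ^ (k + d) = t ^ ((k : ℝ) + d) := by rw [← Nat.cast_add, Real.rpow_natCast]
      _ ≤ t ^ ((1 + ε) * k) := by
        refine Real.rpow_le_rpow_of_exponent_le ht ?_
        rw [div_le_iff₀ hε] at hk
        linarith
      _ = (t ^ (1 + ε)) ^ k := by rw [Real.rpow_mul (by linarith), Real.rpow_natCast]
      _ ≤ ‖w‖ ^ k := by gcongr
  rw [← ENNReal.ofReal_mul (by positivity), ← ofReal_norm]
  refine ENNReal.ofReal_le_ofReal ?_
  rw [Real.rpow_neg (by positivity), Real.rpow_natCast, ← div_eq_mul_inv,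
    le_div_iff₀ (by positivity)]
  exact mul_one_add_pow_le_of_pow_add_mul_le (hone.trans hw) (norm_nonneg _) hC hpow (hCb t ht w)

end ShellKernel

theorem eLpNorm'_mul_le {α : Type*} [MeasurableSpace α] {μ : Measure α} {p q r : ℝ}
    (hpqr : p.HolderTriple q r) {F G : α → ℝ≥0∞} (hF : AEMeasurable F μ) (hG : AEMeasurable G μ) :
    eLpNorm' (fun x => F x * G x) r μ ≤ eLpNorm' F p μ * eLpNorm' G q μ :=
  ENNReal.lintegral_Lp_mul_le_Lq_mul_Lr hpqr.pos' hpqr.lt hpqr.one_div_eq μ hF hG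

theorem lintegral_rpow_le_mul_lintegral_rpow {α : Type*} [MeasurableSpace α] {ν : Measure α}
    {r : ℝ} (hr : 1 ≤ r) {H : α → ℝ≥0∞} (hH : Measurable H) :
    (∫⁻ w, H w ∂ν) ^ r ≤ ν univ ^ (r - 1) * ∫⁻ w, H w ^ r ∂ν := by
  have hr0 : 0 < r := by linarith
  have h := eLpNorm'_le_eLpNorm'_mul_rpow_measure_univ (μ := ν) zero_lt_one hr
    hH.aestronglyMeasurable
  simp only [eLpNorm', enorm_eq_self, ENNReal.rpow_one, div_one] at h
  calc (∫⁻ w, H w ∂ν) ^ r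
      ≤ ((∫⁻ w, H w ^ r ∂ν) ^ (1 / r) * ν univ ^ (1 - 1 / r)) ^ r := by gcongr
    _ = ν univ ^ (r - 1) * ∫⁻ w, H w ^ r ∂ν := by
        rw [ENNReal.mul_rpow_of_nonneg _ _ hr0.le, ← ENNReal.rpow_mul, ← ENNReal.rpow_mul,
          one_div_mul_cancel hr0.ne', ENNReal.rpow_one, sub_mul, one_div_mul_cancel hr0.ne',
          one_mul, mul_comm]

section Averaging

variable {V : Type*} [NormedAddCommGroup V] [MeasurableSpace V] [BorelSpace V] {μ : Measure V}
  {p q r R : ℝ}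

theorem setLIntegral_ball_eq_lintegral_indicator (h : V → ℝ≥0∞) (a : V) :
    ∫⁻ x in Metric.ball a R, h x ∂μ =
      ∫⁻ x, {z : V × V | dist z.2 z.1 < R}.indicator (fun z => h z.2) (a, x) ∂μ := by
  rw [← lintegral_indicator measurableSet_ball]
  rfl

variable [NormedSpace ℝ V] [FiniteDimensional ℝ V]

theorem measurable_indicator_dist_lt {h : V → ℝ≥0∞} (hh : Measurable h) :
    Measurable ({z : V × V | dist z.2 z.1 < R}.indicator fun z => h z.2) :=
  (hh.comp measurable_snd).indicator
    (isOpen_lt (continuous_snd.dist continuous_fst) continuous_const).measurableSet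

variable [μ.IsAddHaarMeasure]

theorem measurable_setLIntegral_ball {h : V → ℝ≥0∞} (hh : Measurable h) :
    Measurable fun a => ∫⁻ x in Metric.ball a R, h x ∂μ := by
  simp_rw [setLIntegral_ball_eq_lintegral_indicator]
  exact (measurable_indicator_dist_lt hh).lintegral_prod_right'

theorem lintegral_setLIntegral_ball {h : V → ℝ≥0∞} (hh : Measurable h) :
    ∫⁻ a, ∫⁻ x in Metric.ball a R, h x ∂μ ∂μ = μ (Metric.ball 0 R) * ∫⁻ x, h x ∂μ := by
  simp_rw [setLIntegral_ball_eq_lintegral_indicator]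
  rw [lintegral_lintegral_swap
      (f := fun a x => {z : V × V | dist z.2 z.1 < R}.indicator (fun z => h z.2) (a, x))
      (measurable_indicator_dist_lt hh).aemeasurable, ← lintegral_const_mul _ hh]
  refine lintegral_congr fun x => ?_
  have hball (a : V) : {z : V × V | dist z.2 z.1 < R}.indicator (fun z => h z.2) (a, x) =
      (Metric.ball x R).indicator (fun _ => h x) a := by
    simp only [indicator, mem_ofPred_eq, Metric.mem_ball, dist_comm]
  simp_rw [hball]
  rw [lintegral_indicator_const measurableSet_ball, Measure.addHaar_ball_center, mul_comm]

theorem measurable_eLpNorm'_restrict_ball {F : V → ℝ≥0∞} (hF : Measurable F) :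
    Measurable fun a => eLpNorm' F p (μ.restrict (Metric.ball a R)) :=
  (measurable_setLIntegral_ball (hF.pow_const p)).pow_const _

theorem eLpNorm'_eLpNorm'_restrict_ball (hp : 0 < p) {F : V → ℝ≥0∞} (hF : Measurable F) :
    eLpNorm' (fun a => eLpNorm' F p (μ.restrict (Metric.ball a R))) p μ =
      μ (Metric.ball 0 R) ^ (1 / p) * eLpNorm' F p μ := by
  rw [eLpNorm']
  simp only [enorm_eq_self, ← lintegral_rpow_enorm_eq_rpow_eLpNorm' hp]
  rw [lintegral_setLIntegral_ball (hF.pow_const p), ENNReal.mul_rpow_of_nonneg _ _ (by positivity)]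
  rfl

theorem eLpNorm'_le_of_forall_eLpNorm'_restrict_ball_le (hpqr : p.HolderTriple q r)
    {T F G : V → ℝ≥0∞} (hT : Measurable T) (hF : Measurable F) (hG : Measurable G) {A : ℝ≥0∞}
    (hR : 0 < R)
    (hA : ∀ a, eLpNorm' T r (μ.restrict (Metric.ball a R)) ≤
      A * (eLpNorm' F p (μ.restrict (Metric.ball a (2 * R))) *
        eLpNorm' G q (μ.restrict (Metric.ball a (2 * R))))) :
    eLpNorm' T r μ ≤
      2 ^ (Module.finrank ℝ V / r) * (A * (eLpNorm' F p μ * eLpNorm' G q μ)) := by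
  have hr := hpqr.pos'
  set v := μ (Metric.ball (0 : V) R)
  have hv0 : v ≠ 0 := (Metric.measure_ball_pos _ _ hR).ne'
  have hv : v ≠ ∞ := measure_ball_lt_top.ne
  have hdouble : μ (Metric.ball (0 : V) (2 * R)) ^ (1 / r) =
      2 ^ (Module.finrank ℝ V / r) * v ^ (1 / r) := by
    rw [Measure.addHaar_ball_mul_of_pos _ _ two_pos, ENNReal.ofReal_pow zero_le_two,
      ENNReal.ofReal_ofNat, ENNReal.mul_rpow_of_nonneg _ _ (by positivity),
      ← ENNReal.rpow_natCast, ← ENNReal.rpow_mul, mul_one_div]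
  have hF' := measurable_eLpNorm'_restrict_ball (μ := μ) (p := p) (R := 2 * R) hF
  have hG' := measurable_eLpNorm'_restrict_ball (μ := μ) (p := q) (R := 2 * R) hG
  refine (ENNReal.mul_le_mul_iff_right (a := v ^ (1 / r)) (by simp [hv0, hv])
    (ENNReal.rpow_ne_top_of_nonneg (by positivity) hv)).1 ?_
  calc v ^ (1 / r) * eLpNorm' T r μ
      = eLpNorm' (fun a => eLpNorm' T r (μ.restrict (Metric.ball a R))) r μ :=
        (eLpNorm'_eLpNorm'_restrict_ball hr hT).symm
    _ ≤ A * eLpNorm' (fun a => eLpNorm' F p (μ.restrict (Metric.ball a (2 * R))) *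
          eLpNorm' G q (μ.restrict (Metric.ball a (2 * R)))) r μ :=
        eLpNorm'_le_mul_eLpNorm'_of_ae_le_mul (hF'.mul hG').aestronglyMeasurable (.of_forall hA) hr
    _ ≤ A * ((μ (Metric.ball 0 (2 * R)) ^ (1 / p) * eLpNorm' F p μ) *
          (μ (Metric.ball 0 (2 * R)) ^ (1 / q) * eLpNorm' G q μ)) := by
        rw [← eLpNorm'_eLpNorm'_restrict_ball hpqr.pos hF,
          ← eLpNorm'_eLpNorm'_restrict_ball hpqr.symm.pos hG]
        gcongr
        exact eLpNorm'_mul_le hpqr hF'.aemeasurable hG'.aemeasurable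
    _ = A * (μ (Metric.ball 0 (2 * R)) ^ (1 / r) * (eLpNorm' F p μ * eLpNorm' G q μ)) := by
        rw [hpqr.one_div_eq, ENNReal.rpow_add_of_nonneg _ _ hpqr.one_div_nonneg
          hpqr.symm.one_div_nonneg]
        ring
    _ = _ := by
        rw [hdouble]
        ring

end Averaging

section Young

variable {V : Type*} [AddGroup V] [MeasurableSpace V] [MeasurableAdd V] [MeasurableSub₂ V]
  {μ : Measure V} [μ.IsAddRightInvariant] {p q r : ℝ}

theorem eLpNorm'_mul_translate_le (hpqr : p.HolderTriple q r) {F G : V → ℝ≥0∞} (hF : Measurable F)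
    (hG : Measurable G) (w : V × V) :
    eLpNorm' (fun x => F (x - w.1) * G (x - w.2)) r μ ≤ eLpNorm' F p μ * eLpNorm' G q μ := by
  refine (eLpNorm'_mul_le hpqr (by fun_prop) (by fun_prop)).trans_eq ?_
  simp only [eLpNorm', enorm_eq_self]
  rw [lintegral_sub_right_eq_self (fun x => F x ^ p),
    lintegral_sub_right_eq_self (fun x => G x ^ q)]

theorem eLpNorm'_lintegral_mul_translate_le [SFinite μ] (hpqr : p.HolderTriple q r) (hr : 1 ≤ r)
    {F G : V → ℝ≥0∞} (hF : Measurable F) (hG : Measurable G) (ν : Measure (V × V)) [SFinite ν] :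
    eLpNorm' (fun x => ∫⁻ w, F (x - w.1) * G (x - w.2) ∂ν) r μ ≤
      ν univ * (eLpNorm' F p μ * eLpNorm' G q μ) := by
  have hr0 := hpqr.pos'
  set N := eLpNorm' F p μ * eLpNorm' G q μ
  have hH : Measurable fun z : V × (V × V) => (F (z.1 - z.2.1) * G (z.1 - z.2.2)) ^ r := by
    fun_prop
  refine (ENNReal.rpow_le_rpow_iff hr0).1 ?_
  rw [← lintegral_rpow_enorm_eq_rpow_eLpNorm' hr0]
  calc ∫⁻ x, ‖∫⁻ w, F (x - w.1) * G (x - w.2) ∂ν‖ₑ ^ r ∂μ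
      ≤ ∫⁻ x, ν univ ^ (r - 1) * ∫⁻ w, (F (x - w.1) * G (x - w.2)) ^ r ∂ν ∂μ :=
        lintegral_mono fun x => lintegral_rpow_le_mul_lintegral_rpow hr (by fun_prop)
    _ = ν univ ^ (r - 1) * ∫⁻ w, ∫⁻ x, (F (x - w.1) * G (x - w.2)) ^ r ∂μ ∂ν := by
        rw [lintegral_const_mul _ hH.lintegral_prod_right',
          lintegral_lintegral_swap hH.aemeasurable]
    _ ≤ ν univ ^ (r - 1) * ∫⁻ _, N ^ r ∂ν := by
        gcongr with w
        calc ∫⁻ x, (F (x - w.1) * G (x - w.2)) ^ r ∂μ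
            = eLpNorm' (fun x => F (x - w.1) * G (x - w.2)) r μ ^ r :=
              lintegral_rpow_enorm_eq_rpow_eLpNorm' (f := fun x => F (x - w.1) * G (x - w.2)) hr0
          _ ≤ N ^ r := by
              gcongr
              exact eLpNorm'_mul_translate_le hpqr hF hG w
    _ = (ν univ * N) ^ r := by
        rw [lintegral_const, ENNReal.mul_rpow_of_nonneg _ N hr0.le, mul_left_comm, mul_comm]
        nth_rw 2 [← ENNReal.rpow_one (ν univ)]
        rw [← ENNReal.rpow_add_of_nonneg _ _ (by linarith) zero_le_one, sub_add_cancel]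

theorem eLpNorm'_lintegral_kernel_mul_translate_le [SFinite μ] (hpqr : p.HolderTriple q r)
    (hr : 1 ≤ r) {F G : V → ℝ≥0∞} (hF : Measurable F) (hG : Measurable G) {k : V × V → ℝ≥0∞}
    (hk : Measurable k) (ν : Measure (V × V)) [SFinite ν] :
    eLpNorm' (fun x => ∫⁻ w, k w * (F (x - w.1) * G (x - w.2)) ∂ν) r μ ≤
      (∫⁻ w, k w ∂ν) * (eLpNorm' F p μ * eLpNorm' G q μ) := by
  have hdensity (x : V) : ∫⁻ w, k w * (F (x - w.1) * G (x - w.2)) ∂ν =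
      ∫⁻ w, F (x - w.1) * G (x - w.2) ∂ν.withDensity k :=
    (lintegral_withDensity_eq_lintegral_mul _ hk (by fun_prop)).symm
  simp_rw [hdensity]
  rw [← setLIntegral_univ, ← withDensity_apply _ MeasurableSet.univ]
  exact eLpNorm'_lintegral_mul_translate_le hpqr hr hF hG _

end Young

section Localize

theorem eLpNorm'_indicator {α E : Type*} [MeasurableSpace α] [NormedAddCommGroup E]
    {μ : Measure α} {s : Set α} (hs : MeasurableSet s) (f : α → E) {p : ℝ} (hp : 0 < p) :
    eLpNorm' (s.indicator f) p μ = eLpNorm' f p (μ.restrict s) := by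
  have hpow (x : α) : ‖s.indicator f x‖ₑ ^ p = s.indicator (fun x => ‖f x‖ₑ ^ p) x := by
    by_cases hx : x ∈ s <;> simp [hx, hp]
  simp_rw [eLpNorm', hpow, lintegral_indicator hs]

theorem enorm_sub_indicator_ball_le {V : Type*} [NormedAddCommGroup V] {f g : V → ℂ} {R : ℝ}
    {a x : V} (hx : x ∈ Metric.ball a R) (c : ℂ) (w : V × V) :
    ‖c * (f (x - w.1) * g (x - w.2)) - c * ((Metric.ball a (2 * R)).indicator f (x - w.1) *
      (Metric.ball a (2 * R)).indicator g (x - w.2))‖ₑ ≤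
    (Metric.ball (0 : V × V) R)ᶜ.indicator
      (fun w => ‖c‖ₑ * (‖f (x - w.1)‖ₑ * ‖g (x - w.2)‖ₑ)) w := by
  set Q := Metric.ball a (2 * R)
  by_cases hw : w ∈ Metric.ball (0 : V × V) R
  · have hmem (y : V) (hy : ‖y‖ ≤ ‖w‖) : x - y ∈ Q := by
      rw [mem_ball_zero_iff] at hw
      rw [mem_ball_iff_norm] at hx ⊢
      calc ‖x - y - a‖ = ‖x - a - y‖ := by rw [sub_right_comm]
        _ ≤ ‖x - a‖ + ‖y‖ := norm_sub_le _ _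
        _ < 2 * R := by linarith
    rw [indicator_of_mem (hmem _ (norm_fst_le w)), indicator_of_mem (hmem _ (norm_snd_le w))]
    simp
  · rw [indicator_of_mem (show w ∈ (Metric.ball (0 : V × V) R)ᶜ from hw), ← mul_sub, enorm_mul]
    gcongr
    by_cases h₁ : x - w.1 ∈ Q <;> by_cases h₂ : x - w.2 ∈ Q <;> simp [h₁, h₂, enorm_mul]

variable {V : Type*} [NormedAddCommGroup V] [InnerProductSpace ℝ V] [FiniteDimensional ℝ V]
  [MeasurableSpace V] [BorelSpace V] {m : V × V → ℂ} {f g : V → ℂ} {p q r R : ℝ}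

theorem integrable_mul_fourier_mul_fourier (hm : Integrable m) (hf : Integrable f)
    (hg : Integrable g) : Integrable fun z : V × V => m z * 𝓕 f z.1 * 𝓕 g z.2 := by
  simp_rw [mul_assoc]
  refine hm.mul_bdd (c := (∫⁻ x, ‖f x‖ₑ).toReal * (∫⁻ x, ‖g x‖ₑ).toReal)
    (((continuous_fourier_of_integrable hf).comp continuous_fst).mul
      ((continuous_fourier_of_integrable hg).comp continuous_snd)).aestronglyMeasurable
    (.of_forall fun z => ?_)
  rw [norm_mul, ← toReal_enorm (𝓕 f z.1), ← toReal_enorm (𝓕 g z.2)]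
  gcongr
  · exact hf.2.ne
  · exact enorm_fourier_le f _
  · exact hg.2.ne
  · exact enorm_fourier_le g _

theorem norm_bilinearKernel_le (m : V × V → ℂ) (w : V × V) :
    ‖bilinearKernel m w‖ ≤ ∫ z, ‖m z‖ :=
  (norm_integral_le_integral_norm _).trans_eq (by simp only [Circle.norm_smul])

theorem integrable_bilinearKernel_mul (hm : Integrable m) (hf : Integrable f) (hg : Integrable g)
    (x : V) : Integrable fun w : V × V => bilinearKernel m w * (f (x - w.1) * g (x - w.2)) :=
  ((hf.comp_sub_left x).mul_prod (hg.comp_sub_left x)).bdd_mul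
    (continuous_bilinearKernel hm).aestronglyMeasurable
    (.of_forall (norm_bilinearKernel_le m))

/-- The contribution to a bilinear multiplier with symbol `m` of the part of its kernel outside the
ball of radius `R`, with absolute values inside the integral. -/
noncomputable def bilinearKernelTail (m : V × V → ℂ) (f g : V → ℂ) (R : ℝ) (x : V) : ℝ≥0∞ :=
  ∫⁻ w in (Metric.ball (0 : V × V) R)ᶜ, ‖bilinearKernel m w‖ₑ * (‖f (x - w.1)‖ₑ * ‖g (x - w.2)‖ₑ)

theorem measurable_bilinearKernelTail (hm : Integrable m) (hf : Measurable f) (hg : Measurable g)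
    (R : ℝ) : Measurable (bilinearKernelTail m f g R) := by
  have hK : Measurable (bilinearKernel m) := (continuous_bilinearKernel hm).measurable
  exact Measurable.lintegral_prod_right' (f := fun z : V × (V × V) =>
    ‖bilinearKernel m z.2‖ₑ * (‖f (z.1 - z.2.1)‖ₑ * ‖g (z.1 - z.2.2)‖ₑ)) (by fun_prop)

theorem enorm_bilinearMultiplier_fourier_le_add_bilinearKernelTail (hm : Integrable m)
    (hf : Integrable f) (hg : Integrable g) {a x : V} (hx : x ∈ Metric.ball a R) :
    ‖bilinearMultiplier m (𝓕 f) (𝓕 g) x‖ₑ ≤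
      ‖bilinearMultiplier m (𝓕 ((Metric.ball a (2 * R)).indicator f))
        (𝓕 ((Metric.ball a (2 * R)).indicator g)) x‖ₑ + bilinearKernelTail m f g R x := by
  have hf' := hf.indicator (s := Metric.ball a (2 * R)) measurableSet_ball
  have hg' := hg.indicator (s := Metric.ball a (2 * R)) measurableSet_ball
  rw [← add_sub_cancel (bilinearMultiplier m (𝓕 ((Metric.ball a (2 * R)).indicator f))
    (𝓕 ((Metric.ball a (2 * R)).indicator g)) x) (bilinearMultiplier m (𝓕 f) (𝓕 g) x)]
  refine (enorm_add_le _ _).trans (add_le_add_right ?_ _)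
  rw [bilinearMultiplier_fourier_eq_integral_kernel hm hf hg,
    bilinearMultiplier_fourier_eq_integral_kernel hm hf' hg',
    ← integral_sub (integrable_bilinearKernel_mul hm hf hg x)
      (integrable_bilinearKernel_mul hm hf' hg' x), bilinearKernelTail,
    ← lintegral_indicator measurableSet_ball.compl]
  exact (enorm_integral_le_lintegral_enorm _).trans
    (lintegral_mono fun w => enorm_sub_indicator_ball_le hx _ w)

theorem eLpNorm'_restrict_ball_enorm_sub_bilinearKernelTail_le (hm : Integrable m)
    (hp : 0 < p) (hq : 0 < q) (hr : 0 ≤ r) {A : ℝ≥0∞} {a : V}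
    (hA : ∀ f g : V → ℂ, Integrable f → Integrable g → MemLp f 2 → MemLp g 2 →
      Function.support f ⊆ Metric.ball a (2 * R) → Function.support g ⊆ Metric.ball a (2 * R) →
      eLpNorm' (bilinearMultiplier m (𝓕 f) (𝓕 g)) r volume ≤
        A * (eLpNorm' f p volume * eLpNorm' g q volume))
    (hf : Integrable f) (hg : Integrable g) (hf2 : MemLp f 2) (hg2 : MemLp g 2) :
    eLpNorm' (fun x => ‖bilinearMultiplier m (𝓕 f) (𝓕 g) x‖ₑ - bilinearKernelTail m f g R x) r
        (volume.restrict (Metric.ball a R)) ≤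
      A * (eLpNorm' f p (volume.restrict (Metric.ball a (2 * R))) *
        eLpNorm' g q (volume.restrict (Metric.ball a (2 * R)))) := by
  set Q := Metric.ball a (2 * R)
  have hQ : MeasurableSet Q := measurableSet_ball
  calc _ ≤ eLpNorm' (bilinearMultiplier m (𝓕 (Q.indicator f)) (𝓕 (Q.indicator g))) r
        (volume.restrict (Metric.ball a R)) :=
        eLpNorm'_mono_enorm_ae hr (ae_restrict_of_forall_mem measurableSet_ball fun x hx =>
          tsub_le_iff_right.2
            (enorm_bilinearMultiplier_fourier_le_add_bilinearKernelTail hm hf hg hx))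
    _ ≤ eLpNorm' (bilinearMultiplier m (𝓕 (Q.indicator f)) (𝓕 (Q.indicator g))) r volume :=
        eLpNorm'_mono_measure _ Measure.restrict_le_self hr
    _ ≤ A * (eLpNorm' (Q.indicator f) p volume * eLpNorm' (Q.indicator g) q volume) :=
        hA _ _ (hf.indicator hQ) (hg.indicator hQ) (hf2.indicator hQ) (hg2.indicator hQ)
          support_indicator_subset support_indicator_subset
    _ = _ := by rw [eLpNorm'_indicator hQ f hp, eLpNorm'_indicator hQ g hq]

theorem eLpNorm'_bilinearMultiplier_fourier_le_of_forall_ball (hm : Integrable m)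
    (hpqr : p.HolderTriple q r) (hr : 1 ≤ r) (hR : 0 < R) {A : ℝ≥0∞}
    (hA : ∀ (a : V) (f g : V → ℂ), Integrable f → Integrable g → MemLp f 2 → MemLp g 2 →
      Function.support f ⊆ Metric.ball a (2 * R) → Function.support g ⊆ Metric.ball a (2 * R) →
      eLpNorm' (bilinearMultiplier m (𝓕 f) (𝓕 g)) r volume ≤
        A * (eLpNorm' f p volume * eLpNorm' g q volume))
    (hfm : Measurable f) (hgm : Measurable g) (hf : Integrable f) (hg : Integrable g)
    (hf2 : MemLp f 2) (hg2 : MemLp g 2) :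
    eLpNorm' (bilinearMultiplier m (𝓕 f) (𝓕 g)) r volume ≤
      (2 ^ (Module.finrank ℝ V / r) * A +
        ∫⁻ w in (Metric.ball (0 : V × V) R)ᶜ, ‖bilinearKernel m w‖ₑ) *
      (eLpNorm' f p volume * eLpNorm' g q volume) := by
  set T := bilinearMultiplier m (𝓕 f) (𝓕 g)
  set tail := bilinearKernelTail m f g R
  have hT : Measurable T :=
    (continuous_bilinearMultiplier (integrable_mul_fourier_mul_fourier hm hf hg)).measurable
  have hK : Measurable (bilinearKernel m) := (continuous_bilinearKernel hm).measurable
  have htail : Measurable tail := measurable_bilinearKernelTail hm hfm hgm R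
  have htail_le : eLpNorm' tail r volume ≤ _ :=
    eLpNorm'_lintegral_kernel_mul_translate_le (μ := volume) hpqr hr hfm.enorm
      hgm.enorm hK.enorm (volume.restrict (Metric.ball (0 : V × V) R)ᶜ)
  have hlocal_le : eLpNorm' (fun x => ‖T x‖ₑ - tail x) r volume ≤ _ :=
    eLpNorm'_le_of_forall_eLpNorm'_restrict_ball_le hpqr (hT.enorm.sub htail) hfm.enorm
      hgm.enorm hR fun a => by
        rw [eLpNorm'_enorm, eLpNorm'_enorm]
        exact eLpNorm'_restrict_ball_enorm_sub_bilinearKernelTail_le hm hpqr.pos hpqr.symm.pos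
          hpqr.nonneg' (hA a) hf hg hf2 hg2
  rw [eLpNorm'_enorm, eLpNorm'_enorm] at hlocal_le htail_le
  calc eLpNorm' T r volume
      ≤ eLpNorm' ((fun x => ‖T x‖ₑ - tail x) + tail) r volume :=
        eLpNorm'_mono_enorm_ae hpqr.nonneg' (.of_forall fun x => le_tsub_add)
    _ ≤ eLpNorm' (fun x => ‖T x‖ₑ - tail x) r volume + eLpNorm' tail r volume :=
        eLpNorm'_add_le (hT.enorm.sub htail).aestronglyMeasurable htail.aestronglyMeasurable hr
    _ ≤ _ := by
        grw [hlocal_le, htail_le]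
        rw [add_mul, mul_assoc]

end Localize

section GlobalShell

/-- The decay exponent lost by the shells of thickness `1/t` on `L^p × L^q → L^r` over an
`n`-dimensional space: the localization losses at scale `t` minus the gain of the shell. The
Bochner-Riesz means are bounded for orders above it. -/
noncomputable def criticalIndex (n : ℕ) (p q r : ℝ) : ℝ :=
  ballLoss n p + ballLoss n q - shellGain r

theorem one_half_sub_one_div_le_ballLoss {n : ℕ} (hn : 1 ≤ n) (p : ℝ) :
    1 / 2 - 1 / p ≤ ballLoss n p :=
  (le_max_right _ _).trans
    (le_mul_of_one_le_left (le_max_left _ _) (by exact_mod_cast hn))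

theorem criticalIndex_nonneg {n : ℕ} (hn : 1 ≤ n) {p q r : ℝ} (hpqr : p.HolderTriple q r) :
    0 ≤ criticalIndex n p q r := by
  have hgain : shellGain r ≤ 1 - 1 / r := min_le_right _ _
  have hsum : 1 / r = 1 / p + 1 / q := hpqr.one_div_add_one_div.symm
  have hp := one_half_sub_one_div_le_ballLoss hn p
  have hq := one_half_sub_one_div_le_ballLoss hn q
  rw [criticalIndex]
  linarith

variable {V : Type*} [NormedAddCommGroup V] [InnerProductSpace ℝ V] [FiniteDimensional ℝ V]
  [MeasurableSpace V] [BorelSpace V] {p q r γ : ℝ}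

theorem exists_eLpNorm'_bilinearMultiplier_shellSymbol_fourier_le
    (hn : 2 ≤ Module.finrank ℝ V) {φ : 𝓢(ℝ, ℂ)} {b : ℝ} (hφ : Function.support φ ⊆ Icc 0 b)
    (hpqr : p.HolderTriple q r) (hr : 1 ≤ r)
    (hγ : criticalIndex (Module.finrank ℝ V) p q r < γ) :
    ∃ C ≠ (∞ : ℝ≥0∞), ∀ t : ℝ, 1 ≤ t → ∀ f g : V → ℂ, Measurable f → Measurable g →
      Integrable f → Integrable g → MemLp f 2 → MemLp g 2 →
      eLpNorm' (bilinearMultiplier (shellSymbol φ t) (𝓕 f) (𝓕 g)) r volume ≤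
        C * ENNReal.ofReal t ^ γ * (eLpNorm' f p volume * eLpNorm' g q volume) := by
  have hp : 1 < p := hr.trans_lt hpqr.lt
  have hq : 1 < q := hr.trans_lt hpqr.symm.lt
  set n := Module.finrank ℝ V
  set κ := ballLoss n p + ballLoss n q with hκ_def
  have hκ : 0 ≤ κ := add_nonneg (ballLoss_nonneg _ _) (ballLoss_nonneg _ _)
  have hγ0 : 0 < γ := (criticalIndex_nonneg (by lia) hpqr).trans_lt hγ
  set ε := (γ - criticalIndex n p q r) / (κ + 1)
  have hε : 0 < ε := div_pos (by linarith) (by linarith)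
  have hexp : -shellGain r + (1 + ε) * κ ≤ γ := by
    have hεκ : ε * (κ + 1) = γ - criticalIndex n p q r := div_mul_cancel₀ _ (by positivity)
    rw [criticalIndex, ← hκ_def] at hεκ
    linarith
  obtain ⟨C, hC, hlocal⟩ :=
    exists_eLpNorm'_bilinearMultiplier_shellSymbol_fourier_le_of_support_subset_ball hn hφ hp hq hr
  obtain ⟨D, hD, htail⟩ :=
    exists_lintegral_enorm_bilinearKernel_shellSymbol_compl_ball_le (V := V) hφ hε
  refine ⟨2 ^ (n / r) * (C * 2 ^ κ) + D, by finiteness, fun t ht f g hfm hgm hf hg hf2 hg2 => ?_⟩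
  have ht0 : 0 < t := one_pos.trans_le ht
  have hτ : 1 ≤ ENNReal.ofReal t := ENNReal.one_le_ofReal.2 ht
  have hR : 1 ≤ t ^ (1 + ε) := Real.one_le_rpow ht (by linarith)
  have hloss : ENNReal.ofReal t ^ (-shellGain r) * ENNReal.ofReal (2 * t ^ (1 + ε)) ^ κ ≤
      2 ^ κ * ENNReal.ofReal t ^ γ := by
    rw [ENNReal.ofReal_mul zero_le_two, ENNReal.mul_rpow_of_nonneg _ _ hκ, ENNReal.ofReal_ofNat,
      ← ENNReal.ofReal_rpow_of_pos ht0, ← ENNReal.rpow_mul, mul_left_comm,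
      ← ENNReal.rpow_add _ _ (by simpa using ht0) ENNReal.ofReal_ne_top]
    gcongr
  refine (eLpNorm'_bilinearMultiplier_fourier_le_of_forall_ball (integrable_shellSymbol hφ ht0)
    hpqr hr (one_pos.trans_le hR) (hlocal t ht0 _ (by linarith)) hfm hgm hf hg hf2 hg2).trans ?_
  gcongr ?_ * _
  grw [hloss, htail t ht]
  calc 2 ^ (n / r) * (C * (2 ^ κ * ENNReal.ofReal t ^ γ)) + D
      ≤ 2 ^ (n / r) * (C * (2 ^ κ * ENNReal.ofReal t ^ γ)) + D * ENNReal.ofReal t ^ γ := by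
        gcongr
        exact le_mul_of_one_le_right' (ENNReal.one_le_rpow hτ hγ0)
    _ = _ := by ring

end GlobalShell

section DyadicProfile

variable {δ s : ℝ}

/-- A smooth bump supported in `[1/2, 2]` whose dilates `u ↦ dyadicBump (2 ^ j * u)`, `j ≥ 0`, add
up to `1` on `[1, ∞)`. -/
noncomputable def dyadicBump (u : ℝ) : ℝ :=
  Real.smoothTransition (2 * u - 1) - Real.smoothTransition (u - 1)

theorem dyadicBump_of_le {u : ℝ} (hu : u ≤ 1 / 2) : dyadicBump u = 0 := by
  rw [dyadicBump, Real.smoothTransition.zero_of_nonpos (by linarith),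
    Real.smoothTransition.zero_of_nonpos (by linarith), sub_zero]

theorem dyadicBump_of_ge {u : ℝ} (hu : 2 ≤ u) : dyadicBump u = 0 := by
  rw [dyadicBump, Real.smoothTransition.one_of_one_le (by linarith),
    Real.smoothTransition.one_of_one_le (by linarith), sub_self]

theorem contDiff_dyadicBump (N : ℕ∞) : ContDiff ℝ N dyadicBump :=
  (Real.smoothTransition.contDiff.comp (by fun_prop)).sub
    (Real.smoothTransition.contDiff.comp (by fun_prop))

theorem support_rpow_mul_dyadicBump_subset (δ : ℝ) :
    Function.support (fun u : ℝ => ((u ^ δ * dyadicBump u : ℝ) : ℂ)) ⊆ Icc (1 / 2) 2 := by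
  intro u hu
  by_contra h
  rw [mem_Icc, not_and_or, not_le, not_le] at h
  apply hu
  rcases h with h | h
  · simp [dyadicBump_of_le h.le]
  · simp [dyadicBump_of_ge h.le]

theorem contDiff_rpow_mul_dyadicBump (δ : ℝ) (N : ℕ∞) :
    ContDiff ℝ N fun u : ℝ => ((u ^ δ * dyadicBump u : ℝ) : ℂ) := by
  refine Complex.ofRealCLM.contDiff.comp (contDiff_iff_contDiffAt.2 fun u => ?_)
  by_cases hu : u < 1 / 2
  · refine (contDiffAt_const (c := (0 : ℝ))).congr_of_eventuallyEq ?_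
    filter_upwards [Iio_mem_nhds hu] with v hv
    change v ^ δ * dyadicBump v = 0
    rw [dyadicBump_of_le (le_of_lt hv), mul_zero]
  · exact (Real.contDiffAt_rpow_const_of_ne (by linarith)).mul (contDiff_dyadicBump N).contDiffAt

/-- The profile `u ^ δ * dyadicBump u` of the dyadic pieces of `u ^ δ`, as a Schwartz function. -/
noncomputable def dyadicProfile (δ : ℝ) : 𝓢(ℝ, ℂ) :=
  (HasCompactSupport.intro' isCompact_Icc isClosed_Icc fun _ hu =>
    Function.notMem_support.1 fun h => hu (support_rpow_mul_dyadicBump_subset δ h)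
    ).toSchwartzMap (contDiff_rpow_mul_dyadicBump δ ⊤)

theorem dyadicProfile_apply (δ u : ℝ) :
    dyadicProfile δ u = ((u ^ δ * dyadicBump u : ℝ) : ℂ) := rfl

theorem support_dyadicProfile_subset (δ : ℝ) : Function.support (dyadicProfile δ) ⊆ Icc 0 2 :=
  (support_rpow_mul_dyadicBump_subset δ).trans (Icc_subset_Icc_left (by norm_num))

theorem two_pow_rpow_neg_mul_dyadicProfile (hs : 0 ≤ s) (j : ℕ) :
    (((2 ^ j) ^ (-δ) : ℝ) : ℂ) * dyadicProfile δ (2 ^ j * s) =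
      ((s ^ δ * (Real.smoothTransition (2 ^ (j + 1) * s - 1) -
        Real.smoothTransition (2 ^ j * s - 1)) : ℝ) : ℂ) := by
  rw [dyadicProfile_apply, dyadicBump, ← Complex.ofReal_mul, Real.mul_rpow (by positivity) hs,
    Real.rpow_neg (by positivity), ← mul_assoc, inv_mul_cancel_left₀ (by positivity),
    ← mul_assoc, ← pow_succ']

theorem sum_two_pow_rpow_neg_mul_dyadicProfile (hδ : δ ≠ 0) (hs : s ≤ 1) (J : ℕ) :
    ∑ j ∈ Finset.range J, (((2 ^ j) ^ (-δ) : ℝ) : ℂ) * dyadicProfile δ (2 ^ j * s) =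
      ((max 0 s ^ δ * Real.smoothTransition (2 ^ J * s - 1) : ℝ) : ℂ) := by
  rcases le_total s 0 with hs0 | hs0
  · rw [max_eq_left hs0, Real.zero_rpow hδ, zero_mul, Complex.ofReal_zero]
    refine Finset.sum_eq_zero fun j _ => ?_
    have hle : 2 ^ j * s ≤ 0 := mul_nonpos_of_nonneg_of_nonpos (by positivity) hs0
    rw [dyadicProfile_apply, dyadicBump_of_le (hle.trans (by norm_num)), mul_zero,
      Complex.ofReal_zero, mul_zero]
  · simp_rw [two_pow_rpow_neg_mul_dyadicProfile hs0]
    rw [max_eq_right hs0, ← Complex.ofReal_sum, ← Finset.mul_sum,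
      Finset.sum_range_sub (fun j => Real.smoothTransition (2 ^ j * s - 1)),
      Real.smoothTransition.zero_of_nonpos (x := 2 ^ 0 * s - 1) (by linarith), sub_zero]

theorem tendsto_max_rpow_mul_smoothTransition (hδ : δ ≠ 0) (s : ℝ) :
    Tendsto (fun J : ℕ => max 0 s ^ δ * Real.smoothTransition (2 ^ J * s - 1)) atTop
      (𝓝 (max 0 s ^ δ)) := by
  rcases le_or_gt s 0 with hs | hs
  · simp only [max_eq_left hs, Real.zero_rpow hδ, zero_mul, tendsto_const_nhds_iff]
  · refine tendsto_const_nhds.congr' ?_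
    filter_upwards [(tendsto_pow_atTop_atTop_of_one_lt (one_lt_two (α := ℝ))).eventually_ge_atTop
      (2 / s)] with J hJ
    rw [div_le_iff₀ hs] at hJ
    rw [Real.smoothTransition.one_of_one_le (by linarith), mul_one]

end DyadicProfile

section BochnerRieszSymbol

variable {V : Type*} [NormedAddCommGroup V] {δ : ℝ}

/-- The symbol `(1 - |ξ|² - |η|²)₊ ^ δ` of the bilinear Bochner-Riesz means. -/
noncomputable def bochnerRieszSymbol (δ : ℝ) (z : V × V) : ℂ :=
  ((max 0 (1 - ‖z.1‖ ^ 2 - ‖z.2‖ ^ 2) ^ δ : ℝ) : ℂ)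

theorem continuous_bochnerRieszSymbol (hδ : 0 ≤ δ) :
    Continuous (bochnerRieszSymbol δ : V × V → ℂ) :=
  Complex.continuous_ofReal.comp
    ((by fun_prop : Continuous fun z : V × V => max 0 (1 - ‖z.1‖ ^ 2 - ‖z.2‖ ^ 2)).rpow_const
      fun _ => .inr hδ)

theorem bochnerRieszSymbol_eq_zero (hδ : δ ≠ 0) {z : V × V} (hz : 1 ≤ ‖z.1‖ ^ 2 + ‖z.2‖ ^ 2) :
    bochnerRieszSymbol δ z = 0 := by
  rw [bochnerRieszSymbol, max_eq_left (by linarith), Real.zero_rpow hδ, Complex.ofReal_zero]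

theorem sum_shellSymbol_dyadicProfile (hδ : δ ≠ 0) (J : ℕ) (z : V × V) :
    ∑ j ∈ Finset.range J,
        ((((2 ^ j) ^ (-δ) : ℝ) : ℂ) • shellSymbol (dyadicProfile δ) (2 ^ j)) z =
      bochnerRieszSymbol δ z *
        Real.smoothTransition (2 ^ J * (1 - ‖z.1‖ ^ 2 - ‖z.2‖ ^ 2) - 1) := by
  rw [bochnerRieszSymbol, ← Complex.ofReal_mul, ← sum_two_pow_rpow_neg_mul_dyadicProfile hδ
    (by linarith [sq_nonneg ‖z.1‖, sq_nonneg ‖z.2‖])]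
  rfl

theorem norm_sum_shellSymbol_dyadicProfile_le (hδ : δ ≠ 0) (J : ℕ) (z : V × V) :
    ‖∑ j ∈ Finset.range J,
      ((((2 ^ j) ^ (-δ) : ℝ) : ℂ) • shellSymbol (dyadicProfile δ) (2 ^ j)) z‖ ≤
      ‖bochnerRieszSymbol δ z‖ := by
  rw [sum_shellSymbol_dyadicProfile hδ, norm_mul, Complex.norm_real,
    Real.norm_of_nonneg (Real.smoothTransition.nonneg _)]
  exact mul_le_of_le_one_right (norm_nonneg _) (Real.smoothTransition.le_one _)

theorem tendsto_sum_shellSymbol_dyadicProfile (hδ : δ ≠ 0) (z : V × V) :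
    Tendsto (fun J => ∑ j ∈ Finset.range J,
      ((((2 ^ j) ^ (-δ) : ℝ) : ℂ) • shellSymbol (dyadicProfile δ) (2 ^ j)) z) atTop
      (𝓝 (bochnerRieszSymbol δ z)) := by
  simp_rw [sum_shellSymbol_dyadicProfile hδ, bochnerRieszSymbol, ← Complex.ofReal_mul]
  exact (Complex.continuous_ofReal.tendsto _).comp (tendsto_max_rpow_mul_smoothTransition hδ _)

variable [InnerProductSpace ℝ V] [FiniteDimensional ℝ V] [MeasurableSpace V] [BorelSpace V]

theorem integrable_bochnerRieszSymbol (hδ : 0 < δ) :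
    Integrable (bochnerRieszSymbol δ : V × V → ℂ) := by
  refine (continuous_bochnerRieszSymbol hδ.le).integrable_of_hasCompactSupport
    (.intro (isCompact_closedBall 0 1) fun z hz => bochnerRieszSymbol_eq_zero hδ.ne' ?_)
  contrapose! hz
  exact mem_closedBall_of_sq_add_sq_le_one hz.le

end BochnerRieszSymbol

section BochnerRiesz

theorem eLpNorm'_le_tsum_of_tendsto_sum {α E : Type*} [MeasurableSpace α] [NormedAddCommGroup E]
    {μ : Measure α} {F : ℕ → α → E} {G : α → E} {r : ℝ} (hr : 1 ≤ r)
    (hF : ∀ j, AEStronglyMeasurable (F j) μ)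
    (hlim : ∀ᵐ x ∂μ, Tendsto (fun J => ∑ j ∈ Finset.range J, F j x) atTop (𝓝 (G x))) :
    eLpNorm' G r μ ≤ ∑' j, eLpNorm' (F j) r μ := by
  simp_rw [← Finset.sum_apply] at hlim
  refine (Lp.eLpNorm'_lim_le_liminf_eLpNorm' (one_pos.trans_le hr)
    (fun J => Finset.aestronglyMeasurable_sum _ fun j _ => hF j) hlim).trans ?_
  refine (liminf_le_liminf (.of_forall fun J =>
    (eLpNorm'_sum_le (fun j _ => hF j) hr).trans (ENNReal.sum_le_tsum _))).trans ?_
  exact (liminf_const _).le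

variable {V : Type*} [NormedAddCommGroup V] [InnerProductSpace ℝ V] [FiniteDimensional ℝ V]
  [MeasurableSpace V] [BorelSpace V] {m : V × V → ℂ} {U W : V → ℂ} {p q r γ δ : ℝ}

theorem bilinearMultiplier_const_smul (c : ℂ) (m : V × V → ℂ) (U W : V → ℂ) :
    bilinearMultiplier (c • m) U W = c • bilinearMultiplier m U W := by
  ext x
  simp only [bilinearMultiplier, Pi.smul_apply, smul_mul_assoc]
  rw [← integral_smul]
  simp_rw [smul_comm c]

theorem tendsto_sum_bilinearMultiplier {ms : ℕ → V × V → ℂ}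
    (hms : ∀ j, Integrable fun z : V × V => ms j z * U z.1 * W z.2)
    (hm : Integrable fun z : V × V => m z * U z.1 * W z.2)
    (hle : ∀ J z, ‖∑ j ∈ Finset.range J, ms j z‖ ≤ ‖m z‖)
    (hlim : ∀ z, Tendsto (fun J => ∑ j ∈ Finset.range J, ms j z) atTop (𝓝 (m z))) (x : V) :
    Tendsto (fun J => ∑ j ∈ Finset.range J, bilinearMultiplier (ms j) U W x) atTop
      (𝓝 (bilinearMultiplier m U W x)) := by
  have hsum (J : ℕ) : ∑ j ∈ Finset.range J, bilinearMultiplier (ms j) U W x =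
      ∫ z : V × V, Real.fourierChar ⟪x, z.1 + z.2⟫ •
        ((∑ j ∈ Finset.range J, ms j z) * U z.1 * W z.2) := by
    simp_rw [Finset.sum_mul, Finset.smul_sum]
    exact (integral_finsetSum _ fun j _ =>
      integrable_fourierChar_smul (by fun_prop) (hms j)).symm
  simp_rw [hsum]
  refine tendsto_integral_of_dominated_convergence _ (fun J => ?_) hm.norm
    (fun J => .of_forall fun z => ?_) (.of_forall fun z => ?_)
  · refine aestronglyMeasurable_fourierChar_smul (by fun_prop) ?_
    simp_rw [Finset.sum_mul]
    exact Finset.aestronglyMeasurable_fun_sum _ fun j _ => (hms j).1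
  · rw [Circle.norm_smul]
    simp only [norm_mul]
    gcongr
    exact hle J z
  · exact (((hlim z).mul_const _).mul_const _).const_smul _

theorem enorm_two_pow_rpow_neg_mul (γ δ : ℝ) (j : ℕ) :
    ‖(((2 ^ j) ^ (-δ) : ℝ) : ℂ)‖ₑ * ENNReal.ofReal (2 ^ j) ^ γ = (2 ^ (γ - δ)) ^ j := by
  rw [← ofReal_norm, Complex.norm_real, Real.norm_of_nonneg (by positivity),
    ← ENNReal.ofReal_rpow_of_pos (by positivity),
    ← ENNReal.rpow_add _ _ (by simp) ENNReal.ofReal_ne_top, neg_add_eq_sub,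
    ENNReal.ofReal_pow zero_le_two, ENNReal.ofReal_ofNat, ← ENNReal.rpow_natCast,
    ← ENNReal.rpow_natCast, ← ENNReal.rpow_mul, ← ENNReal.rpow_mul, mul_comm]

theorem exists_eLpNorm'_bilinearMultiplier_bochnerRieszSymbol_fourier_le
    (hn : 2 ≤ Module.finrank ℝ V) (hpqr : p.HolderTriple q r) (hr : 1 ≤ r)
    (hδ : criticalIndex (Module.finrank ℝ V) p q r < δ) :
    ∃ C ≠ (∞ : ℝ≥0∞), ∀ f g : V → ℂ, Measurable f → Measurable g →
      Integrable f → Integrable g → MemLp f 2 → MemLp g 2 →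
      eLpNorm' (bilinearMultiplier (bochnerRieszSymbol δ) (𝓕 f) (𝓕 g)) r volume ≤
        C * (eLpNorm' f p volume * eLpNorm' g q volume) := by
  have hδ0 : 0 < δ := (criticalIndex_nonneg (by lia) hpqr).trans_lt hδ
  obtain ⟨γ, hγ, hγδ⟩ := exists_between hδ
  obtain ⟨C, hC, hshell⟩ := exists_eLpNorm'_bilinearMultiplier_shellSymbol_fourier_le hn
    (support_dyadicProfile_subset δ) hpqr hr hγ
  have hratio : (2 : ℝ≥0∞) ^ (γ - δ) < 1 :=
    ENNReal.rpow_lt_one_of_one_lt_of_neg (by norm_num) (by linarith)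
  refine ⟨C * (1 - 2 ^ (γ - δ))⁻¹, ENNReal.mul_ne_top hC
    (ENNReal.inv_ne_top.2 (tsub_pos_of_lt hratio).ne'), fun f g hfm hgm hf hg hf2 hg2 => ?_⟩
  set N := eLpNorm' f p volume * eLpNorm' g q volume
  let piece (j : ℕ) : V × V → ℂ :=
    (((2 ^ j) ^ (-δ) : ℝ) : ℂ) • shellSymbol (dyadicProfile δ) (2 ^ j)
  have hint (j : ℕ) : Integrable fun z : V × V => piece j z * 𝓕 f z.1 * 𝓕 g z.2 :=
    integrable_mul_fourier_mul_fourier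
      ((integrable_shellSymbol (support_dyadicProfile_subset δ) (by positivity)).smul _) hf hg
  have hpiece (j : ℕ) : eLpNorm' (bilinearMultiplier (piece j) (𝓕 f) (𝓕 g)) r volume ≤
      C * N * (2 ^ (γ - δ)) ^ j := by
    rw [bilinearMultiplier_const_smul, eLpNorm'_const_smul _ hpqr.pos',
      ← enorm_two_pow_rpow_neg_mul]
    grw [hshell (2 ^ j) (one_le_pow₀ one_le_two) f g hfm hgm hf hg hf2 hg2]
    exact le_of_eq (by ring)
  calc _ ≤ ∑' j, eLpNorm' (bilinearMultiplier (piece j) (𝓕 f) (𝓕 g)) r volume :=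
        eLpNorm'_le_tsum_of_tendsto_sum hr
          (fun j => (continuous_bilinearMultiplier (hint j)).aestronglyMeasurable)
          (.of_forall (tendsto_sum_bilinearMultiplier hint
            (integrable_mul_fourier_mul_fourier (integrable_bochnerRieszSymbol hδ0) hf hg)
            (norm_sum_shellSymbol_dyadicProfile_le hδ0.ne')
            (tendsto_sum_shellSymbol_dyadicProfile hδ0.ne')))
    _ ≤ ∑' j, C * N * (2 ^ (γ - δ)) ^ j := ENNReal.tsum_le_tsum hpiece
    _ = C * (1 - 2 ^ (γ - δ))⁻¹ * N := by
        rw [ENNReal.tsum_mul_left, ENNReal.tsum_geometric]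
        ring

end BochnerRiesz

section Extension

variable {E₁ E₂ X₁ X₂ Y : Type*} [AddCommGroup E₁] [Module ℂ E₁] [AddCommGroup E₂] [Module ℂ E₂]
  [NormedAddCommGroup X₁] [NormedSpace ℂ X₁] [NormedAddCommGroup X₂] [NormedSpace ℂ X₂]
  [NormedAddCommGroup Y] [NormedSpace ℂ Y]

theorem exists_bilinear_extension [CompleteSpace Y] {e₁ : E₁ →ₗ[ℂ] X₁} {e₂ : E₂ →ₗ[ℂ] X₂}
    (h₁ : DenseRange e₁) (h₂ : DenseRange e₂) (B : E₁ →ₗ[ℂ] E₂ →ₗ[ℂ] Y) {C : ℝ} (hC : 0 ≤ C)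
    (hB : ∀ x y, ‖B x y‖ ≤ C * ‖e₁ x‖ * ‖e₂ y‖) :
    ∃ T : X₁ →ₗ[ℂ] X₂ →ₗ[ℂ] Y, (∀ F G, ‖T F G‖ ≤ C * ‖F‖ * ‖G‖) ∧
      ∀ x y, T (e₁ x) (e₂ y) = B x y := by
  have heq (x : E₁) (y : E₂) : (B x).extendOfNorm e₂ (e₂ y) = B x y :=
    LinearMap.extendOfNorm_eq h₂ ⟨C * ‖e₁ x‖, hB x⟩ y
  let T₁ : E₁ →ₗ[ℂ] X₂ →L[ℂ] Y :=
    { toFun := fun x => (B x).extendOfNorm e₂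
      map_add' := fun x x' => LinearMap.extendOfNorm_unique h₂ _ (hB (x + x')) _ (by
        ext y; simp [heq])
      map_smul' := fun c x => LinearMap.extendOfNorm_unique h₂ _ (hB (c • x)) _ (by
        ext y; simp [heq]) }
  have hT₁ (x : E₁) : ‖T₁ x‖ ≤ C * ‖e₁ x‖ :=
    LinearMap.opNorm_extendOfNorm_le h₂ (by positivity) (hB x)
  let T := T₁.extendOfNorm e₁
  refine ⟨(ContinuousLinearMap.coeLM ℂ).comp T.toLinearMap, fun F G => ?_, fun x y => ?_⟩
  · refine ((T F).le_opNorm G).trans ?_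
    gcongr
    exact LinearMap.norm_extendOfNorm_apply_le h₁ C hT₁ F
  · have hT : T (e₁ x) = T₁ x := LinearMap.extendOfNorm_eq h₁ ⟨C, hT₁⟩ x
    change T (e₁ x) (e₂ y) = _
    rw [hT]
    exact heq x y

variable {α : Type*} [MeasurableSpace α] {μ : Measure α} {s : ℝ≥0∞}

/-- A function-valued bilinear map all of whose values lie in `L^s`, as a bilinear map into the
Banach space `L^s`. -/
noncomputable def bilinearToLp (B : E₁ →ₗ[ℂ] E₂ →ₗ[ℂ] (α → Y))
    (hB : ∀ x y, MemLp (B x y) s μ) : E₁ →ₗ[ℂ] E₂ →ₗ[ℂ] Lp Y s μ :=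
  LinearMap.mk₂ ℂ (fun x y => (hB x y).toLp)
    (fun x x' y => (MemLp.toLp_congr _ ((hB x y).add (hB x' y)) (.of_eq (B.map_add₂ x x' y))).trans
      (MemLp.toLp_add _ _))
    (fun c x y => (MemLp.toLp_congr _ ((hB x y).const_smul c) (.of_eq (B.map_smul₂ c x y))).trans
      (MemLp.toLp_const_smul c _))
    (fun x y y' => (MemLp.toLp_congr _ ((hB x y).add (hB x y')) (.of_eq ((B x).map_add y y'))).trans
      (MemLp.toLp_add _ _))
    (fun c x y => (MemLp.toLp_congr _ ((hB x y).const_smul c) (.of_eq ((B x).map_smul c y))).trans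
      (MemLp.toLp_const_smul c _))

end Extension

section SchwartzMultiplier

variable {V : Type*} [NormedAddCommGroup V] [InnerProductSpace ℝ V] [FiniteDimensional ℝ V]
  [MeasurableSpace V] [BorelSpace V] {m : V × V → ℂ} {U U' W W' : V → ℂ}

theorem bilinearMultiplier_add_left (hU : Integrable fun z : V × V => m z * U z.1 * W z.2)
    (hU' : Integrable fun z : V × V => m z * U' z.1 * W z.2) :
    bilinearMultiplier m (U + U') W = bilinearMultiplier m U W + bilinearMultiplier m U' W := by
  ext x
  simp only [bilinearMultiplier, Pi.add_apply, mul_add, add_mul, smul_add]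
  exact integral_add (integrable_fourierChar_smul (by fun_prop) hU)
    (integrable_fourierChar_smul (by fun_prop) hU')

theorem bilinearMultiplier_add_right (hW : Integrable fun z : V × V => m z * U z.1 * W z.2)
    (hW' : Integrable fun z : V × V => m z * U z.1 * W' z.2) :
    bilinearMultiplier m U (W + W') = bilinearMultiplier m U W + bilinearMultiplier m U W' := by
  ext x
  simp only [bilinearMultiplier, Pi.add_apply, mul_add, smul_add]
  exact integral_add (integrable_fourierChar_smul (by fun_prop) hW)
    (integrable_fourierChar_smul (by fun_prop) hW')

theorem bilinearMultiplier_smul_left (c : ℂ) (m : V × V → ℂ) (U W : V → ℂ) :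
    bilinearMultiplier m (c • U) W = c • bilinearMultiplier m U W := by
  rw [← bilinearMultiplier_const_smul]
  ext x
  simp only [bilinearMultiplier, Pi.smul_apply, smul_eq_mul, mul_assoc, mul_left_comm]

theorem bilinearMultiplier_smul_right (c : ℂ) (m : V × V → ℂ) (U W : V → ℂ) :
    bilinearMultiplier m U (c • W) = c • bilinearMultiplier m U W := by
  rw [← bilinearMultiplier_const_smul]
  ext x
  simp only [bilinearMultiplier, Pi.smul_apply, smul_eq_mul, mul_assoc, mul_left_comm]

theorem integrable_mul_fourier_mul_fourier_schwartz (hm : Integrable m) (f g : 𝓢(V, ℂ)) :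
    Integrable fun z : V × V => m z * (𝓕 f : 𝓢(V, ℂ)) z.1 * (𝓕 g : 𝓢(V, ℂ)) z.2 := by
  simp only [fourier_coe]
  exact integrable_mul_fourier_mul_fourier hm f.integrable g.integrable

/-- The bilinear Fourier multiplier operator with integrable symbol `m`, as a bilinear map on
Schwartz functions. -/
noncomputable def schwartzBilinearMultiplier (m : V × V → ℂ) (hm : Integrable m) :
    𝓢(V, ℂ) →ₗ[ℂ] 𝓢(V, ℂ) →ₗ[ℂ] (V → ℂ) :=
  have hint := integrable_mul_fourier_mul_fourier_schwartz hm
  LinearMap.mk₂ ℂ (fun f g => bilinearMultiplier m (𝓕 f : 𝓢(V, ℂ)) (𝓕 g : 𝓢(V, ℂ)))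
    (fun f f' g => by
      rw [FourierTransform.fourier_add]
      exact bilinearMultiplier_add_left (hint f g) (hint f' g))
    (fun c f g => by
      rw [FourierTransform.fourier_smul]
      exact bilinearMultiplier_smul_left c m _ _)
    (fun f g g' => by
      rw [FourierTransform.fourier_add]
      exact bilinearMultiplier_add_right (hint f g) (hint f g'))
    (fun c f g => by
      rw [FourierTransform.fourier_smul]
      exact bilinearMultiplier_smul_right c m _ _)

theorem schwartzBilinearMultiplier_apply (hm : Integrable m) (f g : 𝓢(V, ℂ)) :
    schwartzBilinearMultiplier m hm f g =
      bilinearMultiplier m (𝓕 (f : V → ℂ)) (𝓕 (g : V → ℂ)) := by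
  rw [← fourier_coe, ← fourier_coe]
  rfl

end SchwartzMultiplier

section BoundedBilinearOp

variable {n : ℕ} {p q r δ : ℝ}

theorem isBoundedBilinearOp_of_eLpNorm'_le (hp : 1 ≤ p) (hq : 1 ≤ q) (hr : 1 ≤ r)
    {B : 𝓢(EuclideanSpace ℝ (Fin n), ℂ) →ₗ[ℂ] 𝓢(EuclideanSpace ℝ (Fin n), ℂ) →ₗ[ℂ]
      (EuclideanSpace ℝ (Fin n) → ℂ)}
    (hB : ∀ f g, AEStronglyMeasurable (B f g) volume) {C : ℝ≥0∞} (hC : C ≠ ∞)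
    (hbound : ∀ f g, eLpNorm' (B f g) r volume ≤
      C * (eLpNorm' f p volume * eLpNorm' g q volume)) :
    IsBoundedBilinearOp n p q r fun f g => B f g := by
  have : Fact (1 ≤ ENNReal.ofReal p) := ⟨ENNReal.one_le_ofReal.2 hp⟩
  have : Fact (1 ≤ ENNReal.ofReal q) := ⟨ENNReal.one_le_ofReal.2 hq⟩
  have : Fact (1 ≤ ENNReal.ofReal r) := ⟨ENNReal.one_le_ofReal.2 hr⟩
  simp_rw [← eLpNorm_ofReal_eq_eLpNorm' (one_pos.trans_le hp),
    ← eLpNorm_ofReal_eq_eLpNorm' (one_pos.trans_le hq),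
    ← eLpNorm_ofReal_eq_eLpNorm' (one_pos.trans_le hr)] at hbound
  have hfin (f g : 𝓢(EuclideanSpace ℝ (Fin n), ℂ)) :
      C * (eLpNorm f (ENNReal.ofReal p) volume * eLpNorm g (ENNReal.ofReal q) volume) ≠ ∞ :=
    ENNReal.mul_ne_top hC
      (ENNReal.mul_ne_top (f.memLp _ _).eLpNorm_ne_top (g.memLp _ _).eLpNorm_ne_top)
  have hmem (f g : 𝓢(EuclideanSpace ℝ (Fin n), ℂ)) : MemLp (B f g) (ENNReal.ofReal r) volume :=
    ⟨hB f g, (hbound f g).trans_lt (hfin f g).lt_top⟩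
  have hnorm (f g : 𝓢(EuclideanSpace ℝ (Fin n), ℂ)) : ‖bilinearToLp B hmem f g‖ ≤
      C.toReal * ‖f.toLp (ENNReal.ofReal p) volume‖ * ‖g.toLp (ENNReal.ofReal q) volume‖ := by
    rw [bilinearToLp, LinearMap.mk₂_apply, Lp.norm_toLp, norm_toLp, norm_toLp, mul_assoc,
      ← ENNReal.toReal_mul, ← ENNReal.toReal_mul]
    exact ENNReal.toReal_mono (hfin f g) (hbound f g)
  obtain ⟨T, hT, hTB⟩ := exists_bilinear_extension
    (e₁ := (toLpCLM ℂ ℂ (ENNReal.ofReal p) volume).toLinearMap)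
    (e₂ := (toLpCLM ℂ ℂ (ENNReal.ofReal q) volume).toLinearMap)
    (denseRange_toLpCLM ENNReal.ofReal_ne_top) (denseRange_toLpCLM ENNReal.ofReal_ne_top)
    (bilinearToLp B hmem) ENNReal.toReal_nonneg hnorm
  refine ⟨T, C.toReal, hT, fun f g => ?_⟩
  have hext : T (f.toLp _ volume) (g.toLp _ volume) = (hmem f g).toLp := hTB f g
  rw [hext]
  exact (hmem f g).coeFn_toLp

theorem bilinearBochnerRiesz_eq_bilinearMultiplier (hδ : δ ≠ 0)
    (f g : 𝓢(EuclideanSpace ℝ (Fin n), ℂ)) :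
    bilinearBochnerRiesz n δ f g = bilinearMultiplier (bochnerRieszSymbol δ)
      (𝓕 (f : EuclideanSpace ℝ (Fin n) → ℂ)) (𝓕 (g : EuclideanSpace ℝ (Fin n) → ℂ)) := by
  ext x
  have hoff (z : EuclideanSpace ℝ (Fin n) × EuclideanSpace ℝ (Fin n))
      (hz : z ∉ {z | ‖z.1‖ ^ 2 + ‖z.2‖ ^ 2 ≤ 1}) :
      Real.fourierChar ⟪x, z.1 + z.2⟫ • (bochnerRieszSymbol δ z *
        𝓕 (f : EuclideanSpace ℝ (Fin n) → ℂ) z.1 *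
        𝓕 (g : EuclideanSpace ℝ (Fin n) → ℂ) z.2) = 0 := by
    rw [bochnerRieszSymbol_eq_zero hδ (not_le.1 hz).le, zero_mul, zero_mul, smul_zero]
  rw [bilinearBochnerRiesz, bilinearMultiplier,
    ← setIntegral_eq_integral_of_forall_compl_eq_zero hoff]
  refine setIntegral_congr_fun (measurableSet_le (by fun_prop) measurable_const) fun z hz => ?_
  have hpos : 0 ≤ 1 - ‖z.1‖ ^ 2 - ‖z.2‖ ^ 2 := by
    rw [sub_sub]
    exact sub_nonneg.2 hz
  simp only [bochnerRieszSymbol, max_eq_right hpos, Circle.smul_def, Real.fourierChar_apply,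
    smul_eq_mul, ← mul_assoc, Complex.ofReal_mul, Complex.ofReal_ofNat, mul_right_comm _ Complex.I]

theorem mainTheorem12_general (hn : 2 ≤ n) (hpqr : p.HolderTriple q r) (hr : 1 ≤ r)
    (hδ : criticalIndex n p q r < δ) :
    IsBoundedBilinearOp n p q r (bilinearBochnerRiesz n δ) := by
  have hδ0 : 0 < δ := (criticalIndex_nonneg (by lia) hpqr).trans_lt hδ
  have hm := integrable_bochnerRieszSymbol (V := EuclideanSpace ℝ (Fin n)) hδ0
  have hS : bilinearBochnerRiesz n δ = fun f g => schwartzBilinearMultiplier _ hm f g := by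
    funext f g
    rw [schwartzBilinearMultiplier_apply, bilinearBochnerRiesz_eq_bilinearMultiplier hδ0.ne']
  obtain ⟨C, hC, hbound⟩ := exists_eLpNorm'_bilinearMultiplier_bochnerRieszSymbol_fourier_le
    (V := EuclideanSpace ℝ (Fin n)) (by rwa [finrank_euclideanSpace_fin]) hpqr hr
    (by rwa [finrank_euclideanSpace_fin])
  rw [hS]
  refine isBoundedBilinearOp_of_eLpNorm'_le (hr.trans hpqr.lt.le) (hr.trans hpqr.symm.lt.le) hr
    (fun f g => ?_) hC fun f g => ?_
  · exact (continuous_bilinearMultiplier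
      (integrable_mul_fourier_mul_fourier_schwartz hm f g)).aestronglyMeasurable
  · rw [schwartzBilinearMultiplier_apply]
    exact hbound f g f.continuous.measurable g.continuous.measurable f.integrable g.integrable
      (f.memLp 2 volume) (g.memLp 2 volume)

end BoundedBilinearOp

section CriticalIndex

variable {p q r r' : ℝ}

theorem criticalIndex_comm (n : ℕ) (p q r : ℝ) : criticalIndex n p q r = criticalIndex n q p r := by
  rw [criticalIndex, criticalIndex, add_comm (ballLoss n p)]

theorem criticalIndex_of_two_le (n : ℕ) (hpqr : p.HolderTriple q r) (hr : r.HolderConjugate r')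
    (hp : 2 ≤ p) (hq : 2 ≤ q) (hr' : r' ≤ 2) :
    criticalIndex n p q r = (n - 1) / 2 + n * (1 / r' - 1 / 2) := by
  have hsum := hpqr.one_div_add_one_div
  have hconj := hr.one_div_add_one_div
  have hle := one_div_le_one_div_of_le hr.symm.pos hr'
  rw [criticalIndex, ballLoss_of_two_le n hp, ballLoss_of_two_le n hq, shellGain,
    min_eq_left (by linarith)]
  linear_combination -n * hsum - n * hconj

theorem criticalIndex_of_le_two (n : ℕ) (hr : r.HolderConjugate r') (hp0 : 0 < p) (hp : p ≤ 2)
    (hq : 2 ≤ q) (hr' : 2 ≤ r') :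
    criticalIndex n p q r = n * (1 / 2 - 1 / q) - 1 / r' := by
  have hconj := hr.one_div_add_one_div
  have hle := one_div_le_one_div_of_le two_pos hr'
  rw [criticalIndex, ballLoss_of_le_two n hp0 hp, ballLoss_of_two_le n hq, shellGain,
    min_eq_right (by linarith)]
  linear_combination hconj

end CriticalIndex

theorem mainTheorem12 (n : ℕ) (hn : 2 ≤ n) (p q r r' δ : ℝ)
    (hr : r.HolderConjugate r') (hsum : 1 / p + 1 / q + 1 / r' = 1) :
    (2 ≤ p → 2 ≤ q → r' < 2 →
      ((n : ℝ) - 1) / 2 + n * (1 / r' - 1 / 2) < δ →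
      IsBoundedBilinearOp n p q r (bilinearBochnerRiesz n δ)) ∧
    (1 ≤ p → p < 2 → 2 ≤ q → 2 ≤ r' →
      (n : ℝ) * (1 / 2 - 1 / q) - 1 / r' < δ →
      IsBoundedBilinearOp n p q r (bilinearBochnerRiesz n δ)) ∧
    (1 ≤ q → q < 2 → 2 ≤ p → 2 ≤ r' →
      (n : ℝ) * (1 / 2 - 1 / p) - 1 / r' < δ →
      IsBoundedBilinearOp n p q r (bilinearBochnerRiesz n δ)) := by
  have hpqr (hp : 0 < p) (hq : 0 < q) : p.HolderTriple q r :=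
    ⟨by linear_combination hsum - hr.one_div_add_one_div, hp, hq⟩
  refine ⟨fun hp hq hr' hδ => ?_, fun hp hp2 hq hr' hδ => ?_, fun hq hq2 hp hr' hδ => ?_⟩
  · have hpqr := hpqr (by linarith) (by linarith)
    exact mainTheorem12_general hn hpqr hr.lt.le
      (by rwa [criticalIndex_of_two_le n hpqr hr hp hq hr'.le])
  · exact mainTheorem12_general hn (hpqr (by linarith) (by linarith)) hr.lt.le
      (by rwa [criticalIndex_of_le_two n hr (by linarith) hp2.le hq hr'])
  · exact mainTheorem12_general hn (hpqr (by linarith) (by linarith)) hr.lt.le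
      (by rwa [criticalIndex_comm, criticalIndex_of_le_two n hr (by linarith) hq2.le hp hr'])
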